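/- **Setting.** Let $D$ be an oriented link diagram on the sphere in which every link component passes at least once over and at least once under a crossing. Let $\pi_1(L)$ be the link group, presented by the Wirtinger presentation of $D$, and let $\rho:\pi_1(L)\to \mathrm{PSL}(2,\mathbb C)$ be boundary-parabolic, so that every meridian goes to a parabolic element. For $a=(\alpha,\beta)^T\in\mathbb C^2\setminus\{0\}$ put $M(a)=\begin{pmatrix}1+\alpha\beta&-\alpha^2\\ \beta^2&1-\alpha\beta\end{pmatrix}$, $b*a=M(a)b$, $h(a)=\alpha/\beta\in\mathbb C\cup\{\infty\}$ and $\det(a,b)=a_1b_2-b_1a_2$. An *arc-coloring* of $\rho$ assigns to each arc a vector $a\ne 0$ such that $\pm M(a)$ is the image under $\rho$ of the meridian of the arc. (At a crossing with over-arc $k$, under-arc $l$ to the right of the over-strand and under-arc $m$ to its left, the Wirtinger relation is $m=k\,l\,k^{-1}$, so the colors satisfy $a_m=\pm a_l*a_k$.) A *region-coloring* assigns to each region a vector $\ne 0$ such that the region to the left of a side colored $a$ has color $s*a$ if the region to its right has color $s$. A *side* is a piece of $D$ between two consecutive crossings; it has the color of its arc. The two colorings together form a *shadow-coloring induced by $\rho$*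 if $h(a)\ne h(s)\ne h(s*a)\ne h(a)$ at every side. Turn a crossing $j$ so that its over-strand, colored $a_k$, runs from the upper right to the lower left. Denote the side variables at the lower left, lower right, upper right and upper left by $z_e,z_f,z_g,z_h$, and let $a_l$ be the color at the upper left. The crossing is *degenerate* if $h(a_k)=h(a_l)$; then it carries variables $w_e^j,w_f^j,w_g^j,w_h^j$ with $w_e^jw_g^j=w_f^jw_h^j$, three of them free. Corners that belong to the same side (kinks) have the same variable. Let $V=\sum_jV_j$ with $$V_j=\mathrm{Li}_2\Big(\frac{z_f}{z_e}\Big)-\mathrm{Li}_2\Big(\frac{z_f}{z_g}\Big)+\mathrm{Li}_2\Big(\frac{z_h}{z_g}\Big)-\mathrm{Li}_2\Big(\frac{z_h}{z_e}\Big)$$ if $j$ is non-degenerate, and $$V_j=-\log w_e^j\log z_e+\log w_f^j\log z_f-\log w_g^j\log z_g+\log w_h^j\log z_h$$ if $j$ is degenerate. Let $\mathcal S$ be the set of all $(z,w)$ with $z_k\ne0$ for all $k$, with $\frac{z_f}{z_e},\frac{z_g}{z_f},\frac{z_h}{z_g},\frac{z_e}{z_h},\frac{z_g}{z_e},\frac{z_h}{z_f}\neq1$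 at every non-degenerate crossing and $w_k^j\ne0$ at every degenerate one, that satisfy $$\exp\Big(z_k\frac{\partial V}{\partial z_k}\Big)=1,\qquad \exp\Big(w_k^j\frac{\partial V}{\partial w_k^j}\Big)=1$$ for all $k$ and all degenerate $j$ (for every choice of branches of the logarithms and dilogarithms near the point). **Theorem.** Every such $\rho$ has an arc-coloring, and every arc-coloring of $\rho$ extends to a shadow-coloring induced by $\rho$. Fix a shadow-coloring induced by $\rho$, and let $p\in\mathbb C^2\setminus\{0\}$ be such that $h(p)$ differs from $h$ of all arc-colors and all region-colors. For each side $k$, with color $a$ and with the color $s$ of the region to its right, put $$z_k^{(0)}=\frac{\det(a,p)}{\det(a,s)}.$$ For each degenerate crossing let $s_W,s_S,s_E,s_N$ be the colors of the regions in its west, south, east and north (they are $s,\ s*a_k,\ (s*a_l)*a_k,\ s*a_l$ at a positive crossing and $s*a_l,\ (s*a_l)*a_k,\ s*a_k,\ s$ at a negative one), and put $$(w_e^j)^{(0)}=\frac{\det(s_W,p)}{\det(s_S,p)},\quad (w_f^j)^{(0)}=\frac{\det(s_E,p)}{\det(s_S,p)},\quad (w_g^j)^{(0)}=\frac{\det(s_E,p)}{\det(s_N,p)},\quad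 (w_h^j)^{(0)}=\frac{\det(s_W,p)}{\det(s_N,p)}.$$ Then all denominators are nonzero, $z_k^{(0)}\neq0,\infty$ and $(w_k^j)^{(0)}\ne0,1$ for all $j,k$, and $(z^{(0)},w^{(0)})\in\mathcal S$. Moreover $z_k^{(0)}=1$ if and only if $p\in s+\mathbb Ca$, with $a$ and $s$ the colors in the definition of $z_k^{(0)}$; and for every shadow-coloring induced by $\rho$ the point $p$ can be chosen so that in addition $z_k^{(0)}\ne1$ for all $k$. In particular $\mathcal S\neq\emptyset$ for every boundary-parabolic representation $\rho$ and every arc-coloring of it. -/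

import Mathlib

open Filter Topology

universe u v

noncomputable section

namespace OptLim

/-! ### Plane vectors, the Hopf map and parabolic elements -/

/-- The determinant `det(a, b) = a₁ b₂ - b₁ a₂` of two vectors of `ℂ²`. -/
def det2 (a b : Fin 2 → ℂ) : ℂ := a 0 * b 1 - b 0 * a 1

open Classical in
/-- The Hopf map `(α, β) ↦ α / β ∈ ℂ ∪ {∞}`, applied to representatives `(α, β) ≠ 0`. -/
def hopf (v : Fin 2 → ℂ) : OnePoint ℂ :=
  if v 1 = 0 then OnePoint.infty else ((v 0 / v 1 : ℂ) : OnePoint ℂ)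

/-- The matrix of determinant one attached to `(α, β)`.  For `(α, β) ≠ 0` its class in
`PSL(2, ℂ)` is parabolic, and every parabolic element arises from exactly one pair `±(α, β)`. -/
def parabolicMatrix (v : Fin 2 → ℂ) : Matrix.SpecialLinearGroup (Fin 2) ℂ :=
  ⟨!![1 + v 0 * v 1, -(v 0) ^ 2; (v 1) ^ 2, 1 - v 0 * v 1], by
    rw [Matrix.det_fin_two_of]; ring⟩

/-- The quandle operation `a * b` on representatives in `ℂ²`: the matrix of `b` applied to `a`.
It does not change when `b` is replaced by `-b`. -/
def quandleOp (a b : Fin 2 → ℂ) : Fin 2 → ℂ :=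
  (parabolicMatrix b : Matrix (Fin 2) (Fin 2) ℂ).mulVec a

/-- `PSL(2, ℂ)`. -/
abbrev PSL2C : Type := Matrix.ProjectiveSpecialLinearGroup (Fin 2) ℂ

/-- The class in `PSL(2, ℂ)` of a matrix of determinant one. -/
def toPSL (A : Matrix.SpecialLinearGroup (Fin 2) ℂ) : PSL2C := QuotientGroup.mk A

/-- A parabolic element of `PSL(2, ℂ)`; the identity is not parabolic. -/
def IsParabolicElement (g : PSL2C) : Prop :=
  ∃ A : Matrix.SpecialLinearGroup (Fin 2) ℂ,
    toPSL A = g ∧ (A : Matrix (Fin 2) (Fin 2) ℂ).IsParabolic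

/-! ### Oriented link diagrams -/

/-- The two strands at a crossing. -/
inductive Strand : Type
  | over
  | under

/-- The four corners at a crossing.  The picture is rotated so that the over-strand runs from the
upper right to the lower left: `e` is lower left (over-strand leaving), `f` is lower right,
`g` is upper right (over-strand arriving), `h` is upper left. -/
inductive Corner : Type
  | e
  | f
  | g
  | h

/-- An oriented link diagram on the sphere with set of crossings `X` and set of regions `R`
(no component without crossings), as a combinatorial map.

A *side* is a piece of the diagram between two consecutive crossings.  Each side leaves exactly one
crossing along one of its two strands, so sides are indexed by `X × Strand`:  `(j, t)` is the side
that leaves `j` along the strand `t`.  The side `k` arrives at the crossing `(next k).1` along the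
strand `(next k).2`, and is continued there by the side `next k`.

`left k` and `right k` are the regions on the two sides of `k`, seen along its orientation.
The four equations at a crossing say which sides bound the same region there: in the position
described at `Corner`, the regions in the west, south, north and east, in this order.  At a
positive crossing the under-strand runs from the upper left to the lower right, at a negative one
from the lower right to the upper left.

That the surface is a sphere is expressed by Euler's formula `V - E + F = 1 + c`, with `c` the
number of connected components of the diagram as a plane graph, where `V = |X|`, `E = 2 |X|`,
`F = |R|`, together with the fact that one can walk between any two regions across sides. -/
structure LinkDiagram (X : Type u) (R : Type v) where
  /-- the side that continues a given side behind its end point -/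
  next : Equiv.Perm (X × Strand)
  /-- the sign of a crossing -/
  isPositive : X → Bool
  /-- the region to the left of a side -/
  left : X × Strand → R
  /-- the region to the right of a side -/
  right : X × Strand → R
  positive_corners : ∀ j, isPositive j = true →
    right (j, .over) = right (next.symm (j, .under)) ∧
    left (j, .over) = right (j, .under) ∧
    right (next.symm (j, .over)) = left (next.symm (j, .under)) ∧
    left (next.symm (j, .over)) = left (j, .under)
  negative_corners : ∀ j, isPositive j = false →
    right (j, .over) = left (j, .under) ∧
    left (j, .over) = left (next.symm (j, .under)) ∧
    right (next.symm (j, .over)) = right (j, .under) ∧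
    left (next.symm (j, .over)) = right (next.symm (j, .under))
  regions_connected : ∀ r r' : R,
    Relation.EqvGen (fun r₁ r₂ => ∃ k, left k = r₁ ∧ right k = r₂) r r'
  euler : Nat.card R = Nat.card X + 1 +
    Nat.card (Quot fun j j' : X => ∃ k : X × Strand, k.1 = j ∧ (next k).1 = j')

namespace LinkDiagram

variable {X : Type u} {R : Type v} (D : LinkDiagram X R)

/-- Every component of the link passes somewhere over and somewhere under a crossing. -/
def EveryComponentOverAndUnder : Prop :=
  ∀ k : X × Strand, (∃ n : ℕ, ((D.next ^ n) k).2 = .over) ∧ (∃ n : ℕ, ((D.next ^ n) k).2 = .under)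

/-- The side at a corner of a crossing. -/
def side (j : X) : Corner → X × Strand
  | .e => (j, .over)
  | .f => if D.isPositive j then (j, .under) else D.next.symm (j, .under)
  | .g => D.next.symm (j, .over)
  | .h => if D.isPositive j then D.next.symm (j, .under) else (j, .under)

/-- The arcs of the diagram: sides up to passing over a crossing. -/
def Arc : Type u := Quot fun k k' : X × Strand => ∃ j, k = D.side j .g ∧ k' = D.side j .e

/-- The arc that contains a side. -/
def arc (k : X × Strand) : D.Arc := Quot.mk _ k

/-- The Wirtinger relators: with over-strand `a_k`, under-arc `a_l` to the right of the over-strand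
and under-arc `a_m` to its left, `a_m = a_k a_l a_k⁻¹`. -/
def wirtingerRelators : Set (FreeGroup D.Arc) :=
  Set.range fun j : X =>
    (FreeGroup.of (D.arc (D.side j .f)))⁻¹ * (FreeGroup.of (D.arc (D.side j .e)) *
      FreeGroup.of (D.arc (D.side j .h)) * (FreeGroup.of (D.arc (D.side j .e)))⁻¹)

/-- The link group, by its Wirtinger presentation. -/
abbrev LinkGroup : Type u := PresentedGroup D.wirtingerRelators

/-- The meridian of an arc. -/
def meridian (α : D.Arc) : D.LinkGroup := PresentedGroup.of α

/-- Boundary-parabolic representations.  It is enough to ask this of the meridians: every other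
element of a peripheral subgroup commutes with a meridian, and whatever commutes with a parabolic
element of `PSL(2, ℂ)` is the identity or parabolic with the same fixed point. -/
def IsBoundaryParabolic (ρ : D.LinkGroup →* PSL2C) : Prop :=
  ∀ α : D.Arc, IsParabolicElement (ρ (D.meridian α))

/-! ### Shadow-colorings -/

/-- `a` gives representatives in `ℂ² \ {0}` of the arc-colors `ρ(α)`. -/
structure IsArcColoring (ρ : D.LinkGroup →* PSL2C) (a : D.Arc → Fin 2 → ℂ) : Prop where
  ne_zero : ∀ α, a α ≠ 0
  eq_rho : ∀ α, toPSL (parabolicMatrix (a α)) = ρ (D.meridian α)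

/-- `s` gives representatives in `ℂ² \ {0}` of the colors of a region-coloring: the color to the
left of a side is `s * a`, with `s` the color to its right and `a` the color of its arc. -/
structure IsRegionColoring (a : D.Arc → Fin 2 → ℂ) (s : R → Fin 2 → ℂ) : Prop where
  ne_zero : ∀ r, s r ≠ 0
  left_eq : ∀ k, s (D.left k) = quandleOp (s (D.right k)) (a (D.arc k))

/-- The condition `h(a) ≠ h(s) ≠ h(s * a) ≠ h(a)` at every side. -/
def IsRegular (a : D.Arc → Fin 2 → ℂ) (s : R → Fin 2 → ℂ) : Prop :=
  ∀ k : X × Strand,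
    hopf (a (D.arc k)) ≠ hopf (s (D.right k)) ∧
    hopf (s (D.right k)) ≠ hopf (s (D.left k)) ∧
    hopf (s (D.left k)) ≠ hopf (a (D.arc k))

/-- `p` represents an element whose image under the Hopf map avoids those of all colors. -/
structure Avoids (a : D.Arc → Fin 2 → ℂ) (s : R → Fin 2 → ℂ) (p : Fin 2 → ℂ) : Prop where
  ne_zero : p ≠ 0
  arcs : ∀ α, hopf p ≠ hopf (a α)
  regions : ∀ r, hopf p ≠ hopf (s r)

/-- A crossing is degenerate when the colors of its two strands have the same Hopf image. -/
def IsDegenerate (a : D.Arc → Fin 2 → ℂ) (j : X) : Prop :=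
  hopf (a (D.arc (D.side j .e))) = hopf (a (D.arc (D.side j .h)))

end LinkDiagram

/-! ### Branches of the logarithm and of the dilogarithm -/

/-- The principal value `Li₂(u) = - ∫₀ᵘ log(1 - x) / x dx`, along the segment from `0` to `u`. -/
def dilog (u : ℂ) : ℂ := -∫ t in (0 : ℝ)..1, Complex.log (1 - t * u) / t

/-- `ℓ` is a branch of the logarithm near `x`. -/
structure IsLogBranchAt (ℓ : ℂ → ℂ) (x : ℂ) : Prop where
  analyticAt : AnalyticAt ℂ ℓ x
  exp_eq : ∀ᶠ u in 𝓝 x, Complex.exp (ℓ u) = u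

/-- `F` is a branch of the dilogarithm near `x`.  By the monodromy of `Li₂` around `1` and of `log`
around `0`, the determinations of the dilogarithm are `Li₂ + 2πi m log + 4π² n` with `m`, `n`
integers.  A branch near `x` is a function that is holomorphic near `x` and agrees with one of them
on open sets arbitrarily close to `x` (around `x` itself when `x` is on no branch cut, on one bank
of the cut when it is). -/
structure IsDilogBranchAt (F : ℂ → ℂ) (x : ℂ) : Prop where
  analyticAt : AnalyticAt ℂ F x
  eq_dilog : ∃ m n : ℤ, ∃ᶠ y in 𝓝 x, F =ᶠ[𝓝 y] fun u =>
    dilog u + 2 * Real.pi * Complex.I * m * Complex.log u + 4 * Real.pi ^ 2 * n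

namespace LinkDiagram

variable {X : Type u} {R : Type v} (D : LinkDiagram X R)

/-! ### The potential function -/

/-- Values of the side variables `z_k`. -/
abbrev ZVal (_D : LinkDiagram X R) : Type u := X × Strand → ℂ

/-- Values of the variables `w_k^j` at the degenerate crossings `j`, one for each corner of `j`.
At a kink two corners belong to the same side; their variables are identified below. -/
abbrev WVal (a : D.Arc → Fin 2 → ℂ) : Type u := {j : X // D.IsDegenerate a j} → Corner → ℂ

open Classical in
/-- The four variables `w^j` at a crossing, with one of them expressed by the others through
`w_e w_g = w_f w_h`.  The dependent one is `w_h`, except when the side at `h` occurs twice at the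
crossing; then it is `w_f`. -/
def wEff (j : X) (w : Corner → ℂ) : Corner → ℂ
  | .e => w .e
  | .f => if ∃ c, c ≠ .h ∧ D.side j c = D.side j .h then w .e * w .g / w .h else w .f
  | .g => w .g
  | .h => if ∃ c, c ≠ .h ∧ D.side j c = D.side j .h then w .h else w .e * w .g / w .f

/-- A branch of the potential function near the point `(z, w)`: a branch near that point of each
logarithm and dilogarithm that occurs in it. -/
structure PotentialBranch (a : D.Arc → Fin 2 → ℂ) (z : D.ZVal) (w : D.WVal a) where
  /-- `li j c c'` is the branch of `Li₂` used for `Li₂(z_c / z_c')` -/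
  li : X → Corner → Corner → ℂ → ℂ
  /-- the branch of `log` used for `log z_c` -/
  logz : X → Corner → ℂ → ℂ
  /-- the branch of `log` used for `log w_c` -/
  logw : X → Corner → ℂ → ℂ
  li_branch : ∀ j, ¬ D.IsDegenerate a j →
    ∀ c ∈ ({.f, .h} : Set Corner), ∀ c' ∈ ({.e, .g} : Set Corner),
      IsDilogBranchAt (li j c c') (z (D.side j c) / z (D.side j c'))
  logz_branch : ∀ j, D.IsDegenerate a j → ∀ c, IsLogBranchAt (logz j c) (z (D.side j c))
  logw_branch : ∀ (j : X) (hj : D.IsDegenerate a j) (c : Corner),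
    IsLogBranchAt (logw j c) (D.wEff j (w ⟨j, hj⟩) c)

namespace PotentialBranch

variable {D} {a : D.Arc → Fin 2 → ℂ} {z₀ : D.ZVal} {w₀ : D.WVal a}

/-- The summand of a non-degenerate crossing:
`Li₂(z_f/z_e) - Li₂(z_f/z_g) + Li₂(z_h/z_g) - Li₂(z_h/z_e)`. -/
def nondegTerm (B : D.PotentialBranch a z₀ w₀) (j : X) (z : D.ZVal) : ℂ :=
  B.li j .f .e (z (D.side j .f) / z (D.side j .e))
    - B.li j .f .g (z (D.side j .f) / z (D.side j .g))
    + B.li j .h .g (z (D.side j .h) / z (D.side j .g))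
    - B.li j .h .e (z (D.side j .h) / z (D.side j .e))

/-- The summand of a degenerate crossing:
`- log w_e log z_e + log w_f log z_f - log w_g log z_g + log w_h log z_h`. -/
def degTerm (B : D.PotentialBranch a z₀ w₀) (j : X) (z : D.ZVal) (w : Corner → ℂ) : ℂ :=
  - (B.logw j .e (D.wEff j w .e) * B.logz j .e (z (D.side j .e)))
    + B.logw j .f (D.wEff j w .f) * B.logz j .f (z (D.side j .f))
    - B.logw j .g (D.wEff j w .g) * B.logz j .g (z (D.side j .g))
    + B.logw j .h (D.wEff j w .h) * B.logz j .h (z (D.side j .h))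

open Classical in
/-- The potential function `V(z, w)`, the sum over all crossings. -/
def V [Fintype X] (B : D.PotentialBranch a z₀ w₀) (z : D.ZVal) (w : D.WVal a) : ℂ :=
  ∑ j : X, if hj : D.IsDegenerate a j then B.degTerm j z (w ⟨j, hj⟩) else B.nondegTerm j z

end PotentialBranch

/-! ### The solution set -/

open Classical in
/-- Give the variable `w_k^j` the value `t`. -/
def setW (a : D.Arc → Fin 2 → ℂ) (w : D.WVal a) (j : {j : X // D.IsDegenerate a j})
    (k : X × Strand) (t : ℂ) : D.WVal a :=
  Function.update w j fun c => if D.side j c = k then t else w j c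

open Classical in
/-- The equations `exp(z_k ∂V/∂z_k) = 1` and `exp(w_k^j ∂V/∂w_k^j) = 1` at `(z, w)`, for a branch
of `V` near `(z, w)`. -/
structure SaddleEquations [Fintype X] {a : D.Arc → Fin 2 → ℂ} {z : D.ZVal} {w : D.WVal a}
    (B : D.PotentialBranch a z w) : Prop where
  z_eq : ∀ k : X × Strand,
    Complex.exp (z k * deriv (fun t => B.V (Function.update z k t) w) (z k)) = 1
  w_eq : ∀ (j : {j : X // D.IsDegenerate a j}) (c : Corner),
    Complex.exp (w j c * deriv (fun t => B.V z (D.setW a w j (D.side j c) t)) (w j c)) = 1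

/-- The solution set `𝒮` of the saddle-point equations `ℋ`. -/
structure IsSolution [Fintype X] (a : D.Arc → Fin 2 → ℂ) (z : D.ZVal) (w : D.WVal a) : Prop where
  z_ne_zero : ∀ k, z k ≠ 0
  ratio_ne_one : ∀ j, ¬ D.IsDegenerate a j →
    z (D.side j .f) / z (D.side j .e) ≠ 1 ∧ z (D.side j .g) / z (D.side j .f) ≠ 1 ∧
    z (D.side j .h) / z (D.side j .g) ≠ 1 ∧ z (D.side j .e) / z (D.side j .h) ≠ 1 ∧
    z (D.side j .g) / z (D.side j .e) ≠ 1 ∧ z (D.side j .h) / z (D.side j .f) ≠ 1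
  w_ne_zero : ∀ j c, w j c ≠ 0
  w_rel : ∀ j, w j .e * w j .g = w j .f * w j .h
  w_side : ∀ (j : {j : X // D.IsDegenerate a j}) (c c' : Corner), D.side j c = D.side j c' →
    w j c = w j c'
  exists_branch : Nonempty (D.PotentialBranch a z w)
  saddle : ∀ B : D.PotentialBranch a z w, D.SaddleEquations B

/-- The solution set `𝒮`. -/
def solutionSet [Fintype X] (a : D.Arc → Fin 2 → ℂ) : Set (D.ZVal × D.WVal a) :=
  {x | D.IsSolution a x.1 x.2}

/-! ### The explicit solution -/

/-- `z_k⁽⁰⁾ = det(a, p) / det(a, s)`, with `a` the color of the arc of the side `k` and `s` the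
color of the region to its right. -/
def zSol (a : D.Arc → Fin 2 → ℂ) (s : R → Fin 2 → ℂ) (p : Fin 2 → ℂ) : D.ZVal := fun k =>
  det2 (a (D.arc k)) p / det2 (a (D.arc k)) (s (D.right k))

/-- The regions in the west, south, east and north of a crossing.  With `a_k` the color of the
over-strand and `a_l` that of the under-arc to its right, they are colored
`s`, `s * a_k`, `(s * a_l) * a_k`, `s * a_l` at a positive crossing, and
`s * a_l`, `(s * a_l) * a_k`, `s * a_k`, `s` at a negative one. -/
def west (j : X) : R := D.right (D.side j .e)

/-- The region in the south of a crossing; see `west`. -/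
def south (j : X) : R := D.left (D.side j .e)

/-- The region in the east of a crossing; see `west`. -/
def east (j : X) : R := D.left (D.side j .g)

/-- The region in the north of a crossing; see `west`. -/
def north (j : X) : R := D.right (D.side j .g)

/-- The region whose color occurs in the numerator of `w_c⁽⁰⁾`. -/
def wNum (j : X) : Corner → R
  | .e => D.west j
  | .f => D.east j
  | .g => D.east j
  | .h => D.west j

/-- The region whose color occurs in the denominator of `w_c⁽⁰⁾`. -/
def wDen (j : X) : Corner → R
  | .e => D.south j
  | .f => D.south j
  | .g => D.north j
  | .h => D.north j

/-- The values `w_e⁽⁰⁾`, `w_f⁽⁰⁾`, `w_g⁽⁰⁾`, `w_h⁽⁰⁾` at the degenerate crossings. -/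
def wSol (a : D.Arc → Fin 2 → ℂ) (s : R → Fin 2 → ℂ) (p : Fin 2 → ℂ) : D.WVal a := fun j c =>
  det2 (s (D.wNum j c)) p / det2 (s (D.wDen j c)) p

end LinkDiagram

end OptLim

end

noncomputable section

namespace OptLim

/-! ### Determinants, the Hopf map and parabolic elements -/

/-! Colors. The formula `s * a = s - det(a, s) a` and the invariance of `det` under the operation
carry all the algebra. A parabolic element of PSL(2, ℂ) has a lift of trace 2, which is `M(a)` for a
vector `a` unique up to sign, so arc-colorings exist and the Wirtinger relation gives `a_m = ± a_l *
a_k`. The matrices `M(a)` are then transports across the sides with trivial holonomy around every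
crossing, that is, a flat bundle of rank 2 on the sphere. Its sections are the region-colorings, up
to the condition that no color vanishes. Simple connectedness is replaced by a dimension count:
Euler's formula bounds the space of sections from below by the rank
(`finrank_le_finrank_ker_regionCoboundary`), and connectedness makes evaluation at one region
injective. Hence every vector at a region extends to a section, and a generic section avoids the
finitely many hyperplanes of vanishing or irregular colors. A generic `p` exists for the same
reason.

Equations for `z`. Plücker's relation among the colors at a crossing shows that each difference of
neighbouring values `z` is `det(a_k, a_l)` times `det(r, p)`, with `r` the color of the region
between the two corners, up to a factor common to both differences at `e` or at `g`
(`crossing_differences`). As `exp(x Li₂'(x)) = 1 / (1 - x)` for every branch, the exponentiated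
contribution of a corner of a non-degenerate crossing is a quotient of the `det(r, p)` of its two
adjacent regions (`cornerFactor_eq`). At a degenerate crossing the values `w` are chosen to give the
same quotient. A side contributes `det(left, p) / det(right, p)` at its tail and the inverse at its
head, so the product is 1.

Equations for `w`. At a degenerate crossing `det(a_k, a_l) = 0` makes the four values `z` equal.
Differentiating by a `w` gives an integral combination of the `log z`, and the relation `w_e w_g =
w_f w_h` makes the signed coefficients sum to zero. -/

theorem quandleOp_eq (a b : Fin 2 → ℂ) : quandleOp a b = a - det2 b a • b := by
  ext i
  fin_cases i <;>
    simp [quandleOp, parabolicMatrix, det2, Matrix.mulVec, dotProduct, Fin.sum_univ_two] <;> ring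

theorem det2_swap (a b : Fin 2 → ℂ) : det2 a b = -det2 b a := by
  simp only [det2]; ring

theorem det2_sub_right (a b c : Fin 2 → ℂ) : det2 a (b - c) = det2 a b - det2 a c := by
  simp only [det2, Pi.sub_apply]; ring

theorem det2_smul_right (a : Fin 2 → ℂ) (c : ℂ) (b : Fin 2 → ℂ) :
    det2 a (c • b) = c * det2 a b := by
  simp only [det2, Pi.smul_apply, smul_eq_mul]; ring

/-- `det2 a` as a linear form. -/
def det2Form (a : Fin 2 → ℂ) : Module.Dual ℂ (Fin 2 → ℂ) where
  toFun := det2 a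
  map_add' x y := by simp only [det2, Pi.add_apply]; ring
  map_smul' c x := by simp only [det2, Pi.smul_apply, smul_eq_mul, RingHom.id_apply]; ring

@[simp] theorem det2Form_apply (a b : Fin 2 → ℂ) : det2Form a b = det2 a b := rfl

theorem exists_det2_ne_zero {a : Fin 2 → ℂ} (ha : a ≠ 0) : ∃ b, det2 a b ≠ 0 := by
  by_contra! h
  apply ha
  ext i
  fin_cases i
  · simpa [det2] using h ![0, 1]
  · simpa [det2] using h ![1, 0]

theorem det2_eq_zero_iff {a b : Fin 2 → ℂ} (ha : a ≠ 0) :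
    det2 a b = 0 ↔ ∃ c : ℂ, b = c • a := by
  constructor
  · intro h
    by_cases h0 : a 0 = 0
    · have h1 : a 1 ≠ 0 := by
        intro h1
        exact ha (by ext i; fin_cases i <;> simp [h0, h1])
      refine ⟨b 1 / a 1, ?_⟩
      have : b 0 = 0 := by simpa [det2, h0, h1] using h
      ext i
      fin_cases i <;> simp [h0, this, h1]
    · refine ⟨b 0 / a 0, ?_⟩
      have : b 1 = b 0 / a 0 * a 1 := by
        field_simp
        simp only [det2] at h
        linear_combination h
      ext i
      fin_cases i <;> simp [h0, ← this]
  · rintro ⟨c, rfl⟩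
    simp only [det2, Pi.smul_apply, smul_eq_mul]; ring

theorem hopf_eq_iff {a b : Fin 2 → ℂ} (ha : a ≠ 0) (hb : b ≠ 0) :
    hopf a = hopf b ↔ det2 a b = 0 := by
  have key : ∀ v : Fin 2 → ℂ, v ≠ 0 → v 1 = 0 → v 0 ≠ 0 := fun v hv h1 h0 =>
    hv (by ext i; fin_cases i <;> simp [h0, h1])
  unfold hopf
  by_cases h1 : a 1 = 0 <;> by_cases h2 : b 1 = 0
  · simp [h1, h2, det2]
  · simp [h1, h2, det2, key a ha h1]
  · simp [h1, h2, det2, key b hb h2]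
  · simp only [h1, h2, if_false, OnePoint.coe_eq_coe, det2]
    rw [div_eq_div_iff h1 h2, sub_eq_zero]

theorem det2_quandleOp_quandleOp (a b c : Fin 2 → ℂ) :
    det2 (quandleOp a c) (quandleOp b c) = det2 a b := by
  simp only [quandleOp_eq, det2, Pi.sub_apply, Pi.smul_apply, smul_eq_mul]; ring

theorem det2_quandleOp_right (a b : Fin 2 → ℂ) : det2 a (quandleOp b a) = det2 a b := by
  simp only [quandleOp_eq, det2, Pi.sub_apply, Pi.smul_apply, smul_eq_mul]; ring

theorem det2_self_quandleOp (a s : Fin 2 → ℂ) : det2 s (quandleOp s a) = det2 a s ^ 2 := by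
  simp only [quandleOp_eq, det2, Pi.sub_apply, Pi.smul_apply, smul_eq_mul]; ring

theorem coe_parabolicMatrix (v : Fin 2 → ℂ) :
    (parabolicMatrix v : Matrix (Fin 2) (Fin 2) ℂ) =
      !![1 + v 0 * v 1, -(v 0) ^ 2; (v 1) ^ 2, 1 - v 0 * v 1] := rfl

theorem parabolicMatrix_quandleOp (a b : Fin 2 → ℂ) :
    parabolicMatrix (quandleOp a b) =
      parabolicMatrix b * parabolicMatrix a * (parabolicMatrix b)⁻¹ := by
  rw [eq_mul_inv_iff_mul_eq]
  apply Subtype.ext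
  rw [Matrix.SpecialLinearGroup.coe_mul, Matrix.SpecialLinearGroup.coe_mul]
  simp only [coe_parabolicMatrix, quandleOp_eq, det2, Pi.sub_apply, Pi.smul_apply, smul_eq_mul]
  ext i j
  fin_cases i <;> fin_cases j <;>
    simp [Matrix.mul_apply, Fin.sum_univ_two] <;> ring

theorem toPSL_eq_iff (A B : Matrix.SpecialLinearGroup (Fin 2) ℂ) :
    toPSL A = toPSL B ↔ B = A ∨ B = -A := by
  have h := QuotientGroup.eq (s := Subgroup.center (Matrix.SpecialLinearGroup (Fin 2) ℂ))
    (a := A) (b := B)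
  refine h.trans ?_
  rw [Matrix.SpecialLinearGroup.mem_center_iff]
  constructor
  · rintro ⟨r, hr, hs⟩
    rw [Fintype.card_fin, sq_eq_one_iff] at hr
    rcases hr with rfl | rfl
    · left
      have : A⁻¹ * B = 1 := by
        ext i j
        rw [← hs]; simp
      rw [inv_mul_eq_one] at this
      exact this.symm
    · right
      have : A⁻¹ * B = -1 := by
        ext i j
        rw [← hs]
        fin_cases i <;> fin_cases j <;> simp
      rw [inv_mul_eq_iff_eq_mul] at this
      simpa using this
  · rintro (rfl | rfl)
    · exact ⟨1, by simp, by simp⟩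
    · exact ⟨-1, by simp, by
        ext i j
        fin_cases i <;> fin_cases j <;> simp⟩

theorem toPSL_mul (A B : Matrix.SpecialLinearGroup (Fin 2) ℂ) :
    toPSL (A * B) = toPSL A * toPSL B := rfl

theorem toPSL_inv (A : Matrix.SpecialLinearGroup (Fin 2) ℂ) : toPSL A⁻¹ = (toPSL A)⁻¹ := rfl

/-- The traces are 2 and -2. Hence the sign ambiguity of PSL(2, ℂ) never mixes two of these
matrices. -/
theorem parabolicMatrix_ne_neg (a b : Fin 2 → ℂ) : parabolicMatrix a ≠ -parabolicMatrix b := by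
  intro h
  have h0 := congrArg (fun A : Matrix.SpecialLinearGroup (Fin 2) ℂ =>
    (A : Matrix (Fin 2) (Fin 2) ℂ).trace) h
  simp only [Matrix.SpecialLinearGroup.coe_neg, coe_parabolicMatrix, Matrix.trace_fin_two,
    Matrix.neg_apply, Matrix.of_apply, Matrix.cons_val', Matrix.cons_val_zero,
    Matrix.cons_val_one, Matrix.cons_val_fin_one] at h0
  have : (4 : ℂ) = 0 := by linear_combination h0
  norm_num at this

theorem eq_or_eq_neg_of_parabolicMatrix_eq {a b : Fin 2 → ℂ}
    (h : parabolicMatrix a = parabolicMatrix b) : a = b ∨ a = -b := by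
  have e : ∀ i j, (parabolicMatrix a : Matrix (Fin 2) (Fin 2) ℂ) i j =
    (parabolicMatrix b : Matrix (Fin 2) (Fin 2) ℂ) i j := fun i j => by rw [h]
  have h00 := e 0 0
  have h01 := e 0 1
  have h10 := e 1 0
  simp only [parabolicMatrix, Matrix.of_apply, Matrix.cons_val', Matrix.cons_val_zero,
    Matrix.cons_val_one, Matrix.cons_val_fin_one, neg_inj, add_right_inj] at h00 h01 h10
  rcases sq_eq_sq_iff_eq_or_eq_neg.1 h01 with h0 | h0
  · by_cases hb : b 0 = 0
    · rcases sq_eq_sq_iff_eq_or_eq_neg.1 h10 with h1 | h1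
      · left; ext i; fin_cases i <;> simp [h0, h1]
      · right; ext i; fin_cases i <;> simp [h0, h1, hb]
    · left
      rw [h0] at h00
      have h1 := mul_left_cancel₀ hb h00
      ext i; fin_cases i <;> simp [h0, h1]
  · by_cases hb : b 0 = 0
    · rcases sq_eq_sq_iff_eq_or_eq_neg.1 h10 with h1 | h1
      · left; ext i; fin_cases i <;> simp [h0, h1, hb]
      · right; ext i; fin_cases i <;> simp [h0, h1]
    · right
      rw [h0] at h00
      have h1 : a 1 = -b 1 := mul_left_cancel₀ hb (by linear_combination -h00)
      ext i; fin_cases i <;> simp [h0, h1]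

theorem eq_or_eq_neg_of_toPSL_eq {a b : Fin 2 → ℂ}
    (h : toPSL (parabolicMatrix a) = toPSL (parabolicMatrix b)) : a = b ∨ a = -b := by
  rcases (toPSL_eq_iff _ _).1 h with h | h
  · exact eq_or_eq_neg_of_parabolicMatrix_eq h.symm
  · exact absurd h (parabolicMatrix_ne_neg _ _)

/-- Trace 2 and determinant 1 give `-A₀₁ A₁₀ = (A₀₀ - 1)²`. So square roots `α` of `-A₀₁` and `β` of
`A₁₀` satisfy `αβ = ±(A₀₀ - 1)`, and the sign of `β` can be adjusted. -/
theorem exists_parabolicMatrix_of_trace {A : Matrix.SpecialLinearGroup (Fin 2) ℂ}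
    (hA : (A : Matrix (Fin 2) (Fin 2) ℂ).trace = 2) : ∃ a, parabolicMatrix a = A := by
  have hdet := A.det_coe
  rw [Matrix.det_fin_two] at hdet
  rw [Matrix.trace_fin_two] at hA
  obtain ⟨α, hα⟩ := IsAlgClosed.exists_pow_nat_eq (-(A 0 1)) two_pos
  obtain ⟨β, hβ⟩ := IsAlgClosed.exists_pow_nat_eq (A 1 0) two_pos
  have h11 : A 1 1 = 2 - A 0 0 := by linear_combination hA
  have hsq : (α * β) ^ 2 = (A 0 0 - 1) ^ 2 := by
    rw [mul_pow, hα, hβ]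
    rw [h11] at hdet
    linear_combination hdet
  rcases sq_eq_sq_iff_eq_or_eq_neg.1 hsq with h | h
  · refine ⟨![α, β], ?_⟩
    apply Subtype.ext
    rw [coe_parabolicMatrix]
    ext i j
    fin_cases i <;> fin_cases j <;> simp [hα, hβ, h, h11]
    ring
  · refine ⟨![α, -β], ?_⟩
    apply Subtype.ext
    rw [coe_parabolicMatrix]
    ext i j
    fin_cases i <;> fin_cases j <;> simp [hα, hβ, h, h11]
    ring

theorem exists_parabolicMatrix {g : PSL2C} (hg : IsParabolicElement g) :
    ∃ a : Fin 2 → ℂ, a ≠ 0 ∧ toPSL (parabolicMatrix a) = g := by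
  obtain ⟨A, rfl, hns, hdisc⟩ := hg
  have hneg : toPSL (-A) = toPSL A := (toPSL_eq_iff _ _).2 (Or.inr (neg_neg A).symm)
  rw [Matrix.discr_fin_two, A.det_coe] at hdisc
  have htr : (A : Matrix (Fin 2) (Fin 2) ℂ).trace ^ 2 = 2 ^ 2 := by linear_combination hdisc
  obtain ⟨a, ha⟩ : ∃ a, parabolicMatrix a = A ∨ parabolicMatrix a = -A := by
    rcases sq_eq_sq_iff_eq_or_eq_neg.1 htr with h | h
    · obtain ⟨a, ha⟩ := exists_parabolicMatrix_of_trace h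
      exact ⟨a, Or.inl ha⟩
    · obtain ⟨a, ha⟩ := exists_parabolicMatrix_of_trace (A := -A) (by
        rw [Matrix.SpecialLinearGroup.coe_neg, Matrix.trace_neg, h, neg_neg])
      exact ⟨a, Or.inr ha⟩
  refine ⟨a, ?_, ?_⟩
  · rintro rfl
    have h1 : parabolicMatrix 0 = 1 := by
      apply Subtype.ext
      rw [coe_parabolicMatrix]
      ext i j
      fin_cases i <;> fin_cases j <;> simp
    rw [h1] at ha
    rcases ha with h | h
    · exact hns ⟨1, by rw [← h]; simp⟩
    · refine hns ⟨-1, ?_⟩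
      rw [← neg_neg A, ← h]
      ext i j
      fin_cases i <;> fin_cases j <;> simp
  · rcases ha with h | h
    · rw [h]
    · rw [h, hneg]

theorem quandleOp_neg_right (a b : Fin 2 → ℂ) : quandleOp a (-b) = quandleOp a b := by
  ext i
  simp only [quandleOp_eq, det2, Pi.sub_apply, Pi.smul_apply, Pi.neg_apply, smul_eq_mul]; ring

theorem det2_neg_left (a b : Fin 2 → ℂ) : det2 (-a) b = -det2 a b := by
  simp only [det2, Pi.neg_apply]; ring

namespace LinkDiagram

variable {X : Type u} {R : Type v} (D : LinkDiagram X R)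

theorem arc_side_e (j : X) : D.arc (D.side j .e) = D.arc (D.side j .g) :=
  (Quot.sound ⟨j, rfl, rfl⟩ : D.arc (D.side j .g) = D.arc (D.side j .e)).symm

variable {D}

theorem exists_isArcColoring {ρ : D.LinkGroup →* PSL2C} (hρ : D.IsBoundaryParabolic ρ) :
    ∃ a : D.Arc → Fin 2 → ℂ, D.IsArcColoring ρ a := by
  choose a h0 h1 using fun α => exists_parabolicMatrix (hρ α)
  exact ⟨a, h0, h1⟩

variable {ρ : D.LinkGroup →* PSL2C} {a : D.Arc → Fin 2 → ℂ}

/-- At a crossing, `a_m = ± a_l * a_k`. -/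
theorem IsArcColoring.crossing (ha : D.IsArcColoring ρ a) (j : X) :
    a (D.arc (D.side j .f)) =
        quandleOp (a (D.arc (D.side j .h))) (a (D.arc (D.side j .e))) ∨
      a (D.arc (D.side j .f)) =
        -quandleOp (a (D.arc (D.side j .h))) (a (D.arc (D.side j .e))) := by
  apply eq_or_eq_neg_of_toPSL_eq
  have hrel : (PresentedGroup.mk D.wirtingerRelators)
      ((FreeGroup.of (D.arc (D.side j .f)))⁻¹ * (FreeGroup.of (D.arc (D.side j .e)) *
      FreeGroup.of (D.arc (D.side j .h)) * (FreeGroup.of (D.arc (D.side j .e)))⁻¹)) = 1 :=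
    PresentedGroup.one_of_mem ⟨j, rfl⟩
  rw [map_mul, map_inv, inv_mul_eq_one, map_mul, map_mul, map_inv] at hrel
  have := congrArg ρ hrel
  rw [map_mul, map_mul, map_inv] at this
  rw [parabolicMatrix_quandleOp, toPSL_mul, toPSL_mul, toPSL_inv, ha.eq_rho, ha.eq_rho,
    ha.eq_rho]
  exact this

end LinkDiagram

/-! ### Existence of region-colorings -/

instance : Fintype Strand := ⟨.cons .over {.under} (by simp), fun t => by cases t <;> simp⟩

theorem Strand.univ_eq : (Finset.univ : Finset Strand) = .cons .over {.under} (by simp) := rfl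

theorem Strand.sum_eq {M : Type*} [AddCommMonoid M] (f : Strand → M) :
    ∑ t, f t = f .over + f .under := by
  rw [Strand.univ_eq, Finset.sum_cons, Finset.sum_singleton]

theorem Strand.prod_eq {M : Type*} [CommMonoid M] (f : Strand → M) :
    ∏ t, f t = f .over * f .under := by
  rw [Strand.univ_eq, Finset.prod_cons, Finset.prod_singleton]

theorem Strand.card_eq : Fintype.card Strand = 2 := rfl

/-- A matrix of determinant one as a linear automorphism of `ℂ²`. -/
def slEquiv : Matrix.SpecialLinearGroup (Fin 2) ℂ →* ((Fin 2 → ℂ) ≃ₗ[ℂ] (Fin 2 → ℂ)) :=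
  Matrix.SpecialLinearGroup.toLin'

namespace LinkDiagram

variable {X : Type u} {R : Type v} (D : LinkDiagram X R)

/-! ### Sections of flat bundles on the sphere, by counting dimensions -/

section Flat

open Module

variable {V : Type*} [AddCommGroup V] [Module ℂ V]

/-- The coboundary of a `V`-valued function on the regions, twisted by a transport `m`. -/
def regionCoboundary (m : X × Strand → V ≃ₗ[ℂ] V) : (R → V) →ₗ[ℂ] (X × Strand → V) where
  toFun s k := s (D.left k) - m k (s (D.right k))
  map_add' s t := by ext k; simp; abel
  map_smul' c s := by ext k; simp [smul_sub]

/-- The holonomy around the crossings of a `V`-valued function on the sides; `P` and `Q` are the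
transports for outgoing and for incoming sides. -/
def crossingHolonomy (P Q : X × Strand → V ≃ₗ[ℂ] V) : (X × Strand → V) →ₗ[ℂ] (X → V) where
  toFun u j := ∑ t : Strand, (Q (j, t) (u (D.next.symm (j, t))) - P (j, t) (u (j, t)))
  map_add' s t := by
    ext j
    simp only [Pi.add_apply, map_add, Strand.sum_eq]
    abel
  map_smul' c s := by
    ext j
    simp only [Pi.smul_apply, map_smul, Strand.sum_eq, RingHom.id_apply, smul_add, smul_sub]

/-- The connected components of the diagram. -/
abbrev Component : Type u :=
  Quot fun j j' : X => ∃ k : X × Strand, k.1 = j ∧ (D.next k).1 = j'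

open Classical in
theorem crossingHolonomy_single [Fintype X] (P Q : X × Strand → V ≃ₗ[ℂ] V) (k : X × Strand)
    (v : V) :
    D.crossingHolonomy P Q (Pi.single k v) =
      Pi.single (D.next k).1 (Q (D.next k) v) - Pi.single k.1 (P k v) := by
  ext j
  simp only [crossingHolonomy, LinearMap.coe_mk, AddHom.coe_mk, Finset.sum_sub_distrib,
    Pi.sub_apply]
  congr 1
  · by_cases h : (D.next k).1 = j
    · subst h
      rw [Pi.single_eq_same, Finset.sum_eq_single (D.next k).2]
      · simp
      · intro t _ ht
        rw [Pi.single_eq_of_ne, map_zero]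
        rintro h
        rw [Equiv.symm_apply_eq] at h
        exact ht (congrArg Prod.snd h)
      · simp
    · rw [Pi.single_eq_of_ne (Ne.symm h)]
      refine Finset.sum_eq_zero fun t _ => ?_
      rw [Pi.single_eq_of_ne, map_zero]
      rintro h'
      rw [Equiv.symm_apply_eq] at h'
      exact h (congrArg Prod.fst h').symm
  · by_cases h : k.1 = j
    · subst h
      rw [Pi.single_eq_same, Finset.sum_eq_single k.2]
      · simp
      · intro t _ ht
        rw [Pi.single_eq_of_ne, map_zero]
        rintro h
        exact ht (congrArg Prod.snd h)
      · simp
    · rw [Pi.single_eq_of_ne (Ne.symm h)]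
      refine Finset.sum_eq_zero fun t _ => ?_
      rw [Pi.single_eq_of_ne, map_zero]
      rintro h'
      exact h (congrArg Prod.fst h').symm

-- A functional on `X → V` that kills the range satisfies `φ_{j'} ∘ Q = φ_j ∘ P` along every side
-- from `j` to `j'`. Since `P` and `Q` are invertible, its vanishing at one crossing spreads over
-- the whole connected component, so one crossing per component determines it.
open Classical in
theorem finrank_dualAnnihilator_range_crossingHolonomy_le [Fintype X] [FiniteDimensional ℂ V]
    (P Q : X × Strand → V ≃ₗ[ℂ] V) :
    finrank ℂ (LinearMap.range (D.crossingHolonomy P Q)).dualAnnihilator ≤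
      Nat.card D.Component * finrank ℂ V := by
  let T : (LinearMap.range (D.crossingHolonomy P Q)).dualAnnihilator →ₗ[ℂ]
      (D.Component → Dual ℂ V) :=
    { toFun φ c := φ.1 ∘ₗ LinearMap.single ℂ (fun _ : X => V) c.out
      map_add' _ _ := rfl
      map_smul' _ _ := rfl }
  have hT : Function.Injective T := by
    rw [injective_iff_map_eq_zero]
    intro φ hφ
    have hedge : ∀ k v, φ.1 (Pi.single (D.next k).1 (Q (D.next k) v)) =
        φ.1 (Pi.single k.1 (P k v)) := by
      intro k v
      have h := (Submodule.mem_dualAnnihilator _).1 φ.2 _ ⟨Pi.single k v, rfl⟩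
      rwa [crossingHolonomy_single, map_sub, sub_eq_zero] at h
    have hconn : ∀ j j' : X, Relation.EqvGen
        (fun j j' : X => ∃ k : X × Strand, k.1 = j ∧ (D.next k).1 = j') j j' →
        ((∀ v, φ.1 (Pi.single j v) = 0) ↔ ∀ v, φ.1 (Pi.single j' v) = 0) := by
      intro j j' h
      induction h with
      | rel j j' h =>
        obtain ⟨k, rfl, rfl⟩ := h
        constructor
        · intro h v
          have := hedge k ((Q (D.next k)).symm v)
          rwa [LinearEquiv.apply_symm_apply, h] at this
        · intro h v
          have := hedge k ((P k).symm v)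
          rw [LinearEquiv.apply_symm_apply, h] at this
          exact this.symm
      | refl j => rfl
      | symm j j' _ ih => exact ih.symm
      | trans j j' j'' _ _ ih1 ih2 => exact ih1.trans ih2
    apply Subtype.ext
    refine LinearMap.pi_ext fun j v => ?_
    have hj : Relation.EqvGen
        (fun j j' : X => ∃ k : X × Strand, k.1 = j ∧ (D.next k).1 = j')
        (Quot.out (Quot.mk _ j : D.Component)) j := Quot.eqvGen_exact (Quot.out_eq _)
    refine (hconn _ _ hj).1 (fun v => ?_) v
    exact LinearMap.congr_fun (congrFun hφ (Quot.mk _ j)) v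
  have hle := LinearMap.finrank_le_finrank_of_injective hT
  have : Fintype D.Component := Fintype.ofFinite _
  rwa [Module.finrank_pi_fintype, Finset.sum_const, Subspace.dual_finrank_eq, smul_eq_mul,
    Finset.card_univ, ← Nat.card_eq_fintype_card] at hle

theorem finite_regions [Fintype X] (D : LinkDiagram X R) : Finite R := by
  -- `Nat.card` of an infinite type is 0, while Euler's formula makes it at least 1.
  refine Nat.finite_of_card_ne_zero ?_
  rw [D.euler]
  omega

/-- A flat bundle on the sphere has at least as many sections as the dimension of its fibre. -/
theorem finrank_le_finrank_ker_regionCoboundary [Fintype X] [FiniteDimensional ℂ V]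
    {m P Q : X × Strand → V ≃ₗ[ℂ] V}
    (hflat : ∀ s, D.crossingHolonomy P Q (D.regionCoboundary m s) = 0) :
    finrank ℂ V ≤ finrank ℂ (LinearMap.ker (D.regionCoboundary m)) := by
  have := D.finite_regions
  have : Fintype R := Fintype.ofFinite R
  have hle : LinearMap.range (D.regionCoboundary m) ≤ LinearMap.ker (D.crossingHolonomy P Q) := by
    rintro _ ⟨s, rfl⟩
    exact hflat s
  have h1 := Submodule.finrank_mono hle
  have h2 := (D.regionCoboundary m).finrank_range_add_finrank_ker
  have h3 := (D.crossingHolonomy P Q).finrank_range_add_finrank_ker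
  have h4 := Subspace.finrank_add_finrank_dualAnnihilator_eq
    (LinearMap.range (D.crossingHolonomy P Q))
  have h5 := D.finrank_dualAnnihilator_range_crossingHolonomy_le P Q
  -- With `c` components and fibre dimension `d`, the kernel has dimension at least `|R| d - 2|X| d
  -- + (|X| - c) d`, which is `d` by Euler's formula.
  have he := D.euler
  rw [Module.finrank_pi_fintype, Finset.sum_const, smul_eq_mul, Finset.card_univ] at h2 h3 h4
  rw [Fintype.card_prod, Strand.card_eq] at h3
  rw [Nat.card_eq_fintype_card, Nat.card_eq_fintype_card (α := X)] at he
  rw [he] at h2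
  have e1 : (Fintype.card X + 1 + Nat.card D.Component) * finrank ℂ V =
    Fintype.card X * finrank ℂ V + finrank ℂ V + Nat.card D.Component * finrank ℂ V := by ring
  have e2 : Fintype.card X * 2 * finrank ℂ V = 2 * (Fintype.card X * finrank ℂ V) := by ring
  rw [e2] at h3
  have h2' := h2.trans e1
  omega

theorem eq_zero_of_regionCoboundary_eq_zero {m : X × Strand → V ≃ₗ[ℂ] V} {s : R → V}
    (hs : D.regionCoboundary m s = 0) {r : R} (hr : s r = 0) : s = 0 := by
  have hk : ∀ k, s (D.left k) = m k (s (D.right k)) := fun k => sub_eq_zero.1 (congrFun hs k)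
  have hconn : ∀ r r' : R, Relation.EqvGen
      (fun r₁ r₂ => ∃ k, D.left k = r₁ ∧ D.right k = r₂) r r' → (s r = 0 ↔ s r' = 0) := by
    intro r r' h
    induction h with
    | rel r r' h =>
      obtain ⟨k, rfl, rfl⟩ := h
      rw [hk, LinearEquiv.map_eq_zero_iff]
    | refl r => rfl
    | symm r r' _ ih => exact ih.symm
    | trans r r' r'' _ _ ih1 ih2 => exact ih1.trans ih2
  funext r'
  exact (hconn _ _ (D.regions_connected r r')).1 hr

/-- Every value at a region extends to a section of a flat bundle on the sphere. -/
theorem exists_regionCoboundary_eq_zero [Fintype X] [FiniteDimensional ℂ V]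
    {m P Q : X × Strand → V ≃ₗ[ℂ] V}
    (hflat : ∀ s, D.crossingHolonomy P Q (D.regionCoboundary m s) = 0) (r : R) (v : V) :
    ∃ s, D.regionCoboundary m s = 0 ∧ s r = v := by
  have := D.finite_regions
  have : Fintype R := Fintype.ofFinite R
  let T : LinearMap.ker (D.regionCoboundary m) →ₗ[ℂ] V :=
    LinearMap.proj r ∘ₗ (LinearMap.ker (D.regionCoboundary m)).subtype
  have hinj : Function.Injective T := by
    rw [injective_iff_map_eq_zero]
    intro s hs
    exact Subtype.ext (D.eq_zero_of_regionCoboundary_eq_zero s.2 hs)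
  have hfin : finrank ℂ (LinearMap.ker (D.regionCoboundary m)) = finrank ℂ V :=
    le_antisymm (LinearMap.finrank_le_finrank_of_injective hinj)
      (D.finrank_le_finrank_ker_regionCoboundary hflat)
  obtain ⟨s, hs⟩ := (LinearMap.injective_iff_surjective_of_finrank_eq_finrank hfin).1 hinj v
  exact ⟨s.1, s.2, hs⟩

end Flat

/-! ### Region-colorings as sections, and generic choices -/

variable {D} {ρ : D.LinkGroup →* PSL2C} {a : D.Arc → Fin 2 → ℂ}

/-- The transport across a side. -/
def sideTransport (D : LinkDiagram X R) (a : D.Arc → Fin 2 → ℂ) (k : X × Strand) :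
    (Fin 2 → ℂ) ≃ₗ[ℂ] (Fin 2 → ℂ) := slEquiv (parabolicMatrix (a (D.arc k)))

open Classical in
/-- The transport for an outgoing side in the holonomy of a crossing. -/
def outTransport (D : LinkDiagram X R) (a : D.Arc → Fin 2 → ℂ) :
    X × Strand → (Fin 2 → ℂ) ≃ₗ[ℂ] (Fin 2 → ℂ)
  | (j, .over) => if D.isPositive j then D.sideTransport a (D.side j .f) else .refl ℂ _
  | (j, .under) => if D.isPositive j then .refl ℂ _ else D.sideTransport a (D.side j .e)

open Classical in
/-- The transport for an incoming side in the holonomy of a crossing. -/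
def inTransport (D : LinkDiagram X R) (a : D.Arc → Fin 2 → ℂ) :
    X × Strand → (Fin 2 → ℂ) ≃ₗ[ℂ] (Fin 2 → ℂ)
  | (j, .over) => if D.isPositive j then .refl ℂ _ else D.sideTransport a (D.side j .f)
  | (j, .under) => if D.isPositive j then D.sideTransport a (D.side j .e) else .refl ℂ _

/-- This is the self-distributivity `(s * a_k) * (a_l * a_k) = (s * a_l) * a_k`. The sign in `a_m =
± a_l * a_k` drops out because the operation is even in its second argument. -/
theorem IsArcColoring.sideTransport_comm (ha : D.IsArcColoring ρ a) (j : X) (s : Fin 2 → ℂ) :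
    D.sideTransport a (D.side j .f) (D.sideTransport a (D.side j .e) s) =
      D.sideTransport a (D.side j .e) (D.sideTransport a (D.side j .h) s) := by
  have h : quandleOp (quandleOp s (a (D.arc (D.side j .e)))) (a (D.arc (D.side j .f))) =
      quandleOp (quandleOp s (a (D.arc (D.side j .h)))) (a (D.arc (D.side j .e))) := by
    have h' : quandleOp (quandleOp s (a (D.arc (D.side j .e)))) (a (D.arc (D.side j .f))) =
      quandleOp (quandleOp s (a (D.arc (D.side j .e))))
        (quandleOp (a (D.arc (D.side j .h))) (a (D.arc (D.side j .e)))) := by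
      rcases ha.crossing j with h | h <;> rw [h]
      rw [quandleOp_neg_right]
    rw [h', quandleOp_eq (quandleOp s _) (quandleOp _ _), det2_quandleOp_quandleOp]
    ext i
    simp only [quandleOp_eq, det2, Pi.sub_apply, Pi.smul_apply, smul_eq_mul]
    ring
  exact h

/-- The in- and out-transports carry all four values to the region to the left of both strands (east
at a positive crossing, south at a negative one). There the sum telescopes to the difference of the
two ways of moving the color from the opposite region around the crossing. -/
theorem IsArcColoring.crossingHolonomy_regionCoboundary (ha : D.IsArcColoring ρ a)
    (s : R → Fin 2 → ℂ) :
    D.crossingHolonomy (D.outTransport a) (D.inTransport a)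
      (D.regionCoboundary (D.sideTransport a) s) = 0 := by
  funext j
  have hK : D.sideTransport a (D.next.symm (j, .over)) = D.sideTransport a (D.side j .e) := by
    simp only [sideTransport]
    rw [D.arc_side_e j]; rfl
  simp only [crossingHolonomy, regionCoboundary, LinearMap.coe_mk, AddHom.coe_mk, Strand.sum_eq,
    Pi.zero_apply, outTransport, inTransport]
  by_cases hp : D.isPositive j = true
  · obtain ⟨c1, c2, c3, c4⟩ := D.positive_corners j hp
    have hc := ha.sideTransport_comm j (s (D.right (j, .over)))
    rw [hK]
    simp only [side, hp, if_true, LinearEquiv.refl_apply, map_sub] at hc ⊢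
    rw [← c2, ← c3, ← c4, ← c1, hc]
    abel
  · have hp' : D.isPositive j = false := by simpa using hp
    obtain ⟨c1, c2, c3, c4⟩ := D.negative_corners j hp'
    have hc := ha.sideTransport_comm j (s (D.right (j, .under)))
    rw [hK]
    simp only [side, hp', if_false, LinearEquiv.refl_apply, map_sub, Bool.false_eq_true] at hc ⊢
    rw [← c2, c3, ← c1, c4, hc]
    abel

theorem isRegionColoring_of_regionCoboundary_eq_zero {s : R → Fin 2 → ℂ}
    (hs : D.regionCoboundary (D.sideTransport a) s = 0) (h0 : ∀ r, s r ≠ 0) :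
    D.IsRegionColoring a s :=
  ⟨h0, fun k => sub_eq_zero.1 (congrFun hs k)⟩

/-- The three inequalities are one condition, since `det(s, s * a) = det(a, s)²` and `det(a, s * a)
= det(a, s)`. -/
theorem IsRegionColoring.isRegular_iff (ha : D.IsArcColoring ρ a) {s : R → Fin 2 → ℂ}
    (hs : D.IsRegionColoring a s) :
    D.IsRegular a s ↔ ∀ k, det2 (a (D.arc k)) (s (D.right k)) ≠ 0 := by
  refine forall_congr' fun k => ?_
  rw [Ne, hopf_eq_iff (ha.ne_zero _) (hs.ne_zero _), Ne,
    hopf_eq_iff (hs.ne_zero _) (hs.ne_zero _), Ne, hopf_eq_iff (hs.ne_zero _) (ha.ne_zero _),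
    hs.left_eq, det2_self_quandleOp, det2_swap (quandleOp _ _), det2_quandleOp_right]
  simp

theorem IsArcColoring.exists_isRegionColoring [Fintype X] (ha : D.IsArcColoring ρ a) :
    ∃ s : R → Fin 2 → ℂ, D.IsRegionColoring a s ∧ D.IsRegular a s := by
  have := D.finite_regions
  let f : (X × Strand) ⊕ R → Module.Dual ℂ (R → Fin 2 → ℂ) := Sum.elim
    (fun k => det2Form (a (D.arc k)) ∘ₗ LinearMap.proj (D.right k))
    -- A nonzero first coordinate is more than a nonzero color, but it is an open condition given by
    -- a single linear form.
    (fun r => LinearMap.proj 0 ∘ₗ LinearMap.proj r)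
  obtain ⟨s, hs, h⟩ := Module.Dual.exists_forall_mem_ne_zero_of_forall_exists
    (LinearMap.ker (D.regionCoboundary (D.sideTransport a))) f (by
      rintro (k | r)
      · obtain ⟨v, hv⟩ := exists_det2_ne_zero (ha.ne_zero (D.arc k))
        obtain ⟨s, hs, rfl⟩ := D.exists_regionCoboundary_eq_zero
          ha.crossingHolonomy_regionCoboundary (D.right k) v
        exact ⟨s, hs, hv⟩
      · obtain ⟨s, hs, h⟩ := D.exists_regionCoboundary_eq_zero
          ha.crossingHolonomy_regionCoboundary r 1
        exact ⟨s, hs, by simp [f, h]⟩)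
  have hcol := isRegionColoring_of_regionCoboundary_eq_zero hs
    (fun r hr => h (Sum.inr r) (by simp [f, hr]))
  exact ⟨s, hcol, (hcol.isRegular_iff ha).2 fun k => h (Sum.inl k)⟩

/-- A generic `p` avoids all colors and satisfies `z_k ≠ 1` for all sides. -/
theorem IsArcColoring.exists_avoids [Fintype X] (ha : D.IsArcColoring ρ a) {s : R → Fin 2 → ℂ}
    (hs : D.IsRegionColoring a s) :
    ∃ p : Fin 2 → ℂ, D.Avoids a s p ∧ ∀ k, D.zSol a s p k ≠ 1 := by
  have := D.finite_regions
  have : Finite D.Arc := inferInstanceAs (Finite (Quot _))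
  let f : (D.Arc ⊕ R) ⊕ Unit → Module.Dual ℂ (Fin 2 → ℂ) := Sum.elim (Sum.elim
    (fun α => det2Form (a α)) (fun r => det2Form (s r))) (fun _ => LinearMap.proj 0)
  obtain ⟨p, hp⟩ := Module.Dual.exists_forall_ne_zero_of_forall_exists f (by
    rintro ((α | r) | _)
    · exact exists_det2_ne_zero (ha.ne_zero α)
    · exact exists_det2_ne_zero (hs.ne_zero r)
    · exact ⟨1, by simp [f]⟩)
  have hp0 : p ≠ 0 := by
    rintro rfl
    exact hp (Sum.inr ()) (by simp)
  -- Rescaling `p` by `t ≠ 0` keeps its Hopf image and multiplies every `z_k` by `t`, so only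
  -- finitely many `t` are bad.
  let bad : Set ℂ := insert 0 (Set.range fun k =>
    det2 (a (D.arc k)) (s (D.right k)) / det2 (a (D.arc k)) p)
  have hbad : bad.Finite := (Set.finite_range _).insert 0
  obtain ⟨t, ht⟩ := hbad.infinite_compl.nonempty
  have ht0 : t ≠ 0 := fun h => ht (Or.inl h)
  have htp : t • p ≠ 0 := smul_ne_zero ht0 hp0
  refine ⟨t • p, ⟨htp, fun α => ?_, fun r => ?_⟩, fun k hk => ht (Or.inr ⟨k, ?_⟩)⟩
  · rw [ne_comm, Ne, hopf_eq_iff (ha.ne_zero α) htp, det2_smul_right]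
    exact mul_ne_zero ht0 (hp (Sum.inl (Sum.inl α)))
  · rw [ne_comm, Ne, hopf_eq_iff (hs.ne_zero r) htp, det2_smul_right]
    exact mul_ne_zero ht0 (hp (Sum.inl (Sum.inr r)))
  · have hk' := eq_of_div_eq_one hk
    have h1 : det2 (a (D.arc k)) p ≠ 0 := hp (Sum.inl (Sum.inl _))
    rw [det2_smul_right] at hk'
    exact (eq_div_of_mul_eq h1 hk').symm

end LinkDiagram

/-! ### The dilogarithm -/

theorem slitPlane_one_sub_mul {u : ℂ} (hu : 1 - u ∈ Complex.slitPlane) {t : ℝ}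
    (ht : t ∈ Set.Icc (0 : ℝ) 1) : 1 - t * u ∈ Complex.slitPlane := by
  have h := Complex.starConvex_one_slitPlane hu (sub_nonneg.2 ht.2) ht.1 (sub_add_cancel 1 t)
  convert h using 1
  simp only [Complex.real_smul]
  push_cast
  ring

theorem integral_inv_one_sub_mul {u : ℂ} (hu : 1 - u ∈ Complex.slitPlane) (h0 : u ≠ 0) :
    ∫ t in (0 : ℝ)..1, (1 - t * u)⁻¹ = -Complex.log (1 - u) / u := by
  have hd : ∀ t ∈ Set.uIcc (0 : ℝ) 1,
      HasDerivAt (fun t : ℝ => -Complex.log (1 - t * u) / u) ((1 - t * u)⁻¹) t := by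
    intro t ht
    rw [Set.uIcc_of_le zero_le_one] at ht
    have hs := slitPlane_one_sub_mul hu ht
    have h1 : HasDerivAt (fun t : ℝ => 1 - (t : ℂ) * u) (-u) t := by
      simpa using ((Complex.ofRealCLM.hasDerivAt (x := t)).mul_const u).const_sub 1
    refine (((h1.clog_real hs).neg).div_const u).congr_deriv ?_
    field_simp
  have hc : ContinuousOn (fun t : ℝ => (1 - (t : ℂ) * u)⁻¹) (Set.uIcc 0 1) := by
    refine ContinuousOn.inv₀ (by fun_prop) fun t ht => ?_
    rw [Set.uIcc_of_le zero_le_one] at ht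
    exact Complex.slitPlane_ne_zero (slitPlane_one_sub_mul hu ht)
  rw [intervalIntegral.integral_eq_sub_of_hasDerivAt hd hc.intervalIntegrable]
  simp

/-- The singularity at `t = 0` is removable: the integrand is the difference quotient at 0 of `t ↦
log(1 - t u)`, which extends continuously by the derivative. -/
theorem intervalIntegrable_log_one_sub_mul_div {u : ℂ} (hu : 1 - u ∈ Complex.slitPlane) :
    IntervalIntegrable (fun t : ℝ => Complex.log (1 - t * u) / t) MeasureTheory.volume 0 1 := by
  set f : ℝ → ℂ := fun t => Complex.log (1 - t * u)
  have hd : ∀ t ∈ Set.Icc (0 : ℝ) 1, HasDerivAt f (-u / (1 - t * u)) t := by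
    intro t ht
    have hs := slitPlane_one_sub_mul hu ht
    have h1 : HasDerivAt (fun t : ℝ => 1 - (t : ℂ) * u) (-u) t := by
      simpa using ((Complex.ofRealCLM.hasDerivAt (x := t)).mul_const u).const_sub 1
    exact h1.clog_real hs
  have hc : ContinuousOn (dslope f 0) (Set.uIcc 0 1) := by
    intro t ht
    rw [Set.uIcc_of_le zero_le_one] at ht
    rcases eq_or_ne t 0 with rfl | h0
    · exact (continuousAt_dslope_same.2 (hd 0 ht).differentiableAt).continuousWithinAt
    · exact ((continuousAt_dslope_of_ne h0).2 (hd t ht).continuousAt).continuousWithinAt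
  refine hc.intervalIntegrable.congr fun t ht => ?_
  rw [Set.uIoc_of_le zero_le_one] at ht
  rw [dslope_of_ne _ ht.1.ne', slope_def_module]
  simp [f, div_eq_inv_mul]

/-- Differentiation under the integral: the derivative `-(1 - t v)⁻¹` of the integrand is
continuous, hence bounded, for `t` in `[0, 1]` and `v` in a small closed ball. -/
theorem hasDerivAt_dilog {u : ℂ} (hu : 1 - u ∈ Complex.slitPlane) (h0 : u ≠ 0) :
    HasDerivAt dilog (-Complex.log (1 - u) / u) u := by
  have hopen : IsOpen {v : ℂ | 1 - v ∈ Complex.slitPlane} :=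
    Complex.isOpen_slitPlane.preimage (by fun_prop)
  obtain ⟨ε, hε, hball⟩ := Metric.nhds_basis_closedBall.mem_iff.1 (hopen.mem_nhds hu)
  have hcompact : IsCompact (Set.Icc (0 : ℝ) 1 ×ˢ Metric.closedBall u ε) :=
    isCompact_Icc.prod (isCompact_closedBall u ε)
  have hne : ∀ q ∈ Set.Icc (0 : ℝ) 1 ×ˢ Metric.closedBall u ε, 1 - (q.1 : ℂ) * q.2 ≠ 0 :=
    fun q hq => Complex.slitPlane_ne_zero (slitPlane_one_sub_mul (hball hq.2) hq.1)
  obtain ⟨C, hC⟩ := hcompact.exists_bound_of_continuousOn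
    (f := fun q : ℝ × ℂ => -(1 - (q.1 : ℂ) * q.2)⁻¹)
    (ContinuousOn.neg (ContinuousOn.inv₀ (by fun_prop) hne))
  have hu' : Metric.closedBall u ε ∈ 𝓝 u := Metric.closedBall_mem_nhds u hε
  have key := intervalIntegral.hasDerivAt_integral_of_dominated_loc_of_deriv_le
    (μ := MeasureTheory.volume) (a := 0) (b := 1) (x₀ := u) (s := Metric.closedBall u ε)
    (F := fun v (t : ℝ) => Complex.log (1 - t * v) / t)
    (F' := fun v (t : ℝ) => -(1 - (t : ℂ) * v)⁻¹) (bound := fun _ => C) hu'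
    (by
      filter_upwards [hu'] with v hv
      exact (intervalIntegrable_iff.1
        (intervalIntegrable_log_one_sub_mul_div (hball hv))).aestronglyMeasurable)
    (intervalIntegrable_log_one_sub_mul_div hu)
    (by
      refine Measurable.aestronglyMeasurable ?_
      fun_prop)
    (by
      refine Eventually.of_forall fun t ht v hv => ?_
      rw [Set.uIoc_of_le zero_le_one] at ht
      exact hC (t, v) ⟨⟨ht.1.le, ht.2⟩, hv⟩)
    intervalIntegrable_const
    (by
      refine Eventually.of_forall fun t ht v hv => ?_
      rw [Set.uIoc_of_le zero_le_one] at ht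
      have ht0 : (t : ℂ) ≠ 0 := by exact_mod_cast ht.1.ne'
      have hs := slitPlane_one_sub_mul (hball hv) (t := t) ⟨ht.1.le, ht.2⟩
      have h1 : HasDerivAt (fun v : ℂ => 1 - (t : ℂ) * v) (-t) v := by
        simpa using ((hasDerivAt_id v).const_mul (t : ℂ)).const_sub 1
      refine ((h1.clog hs).div_const (t : ℂ)).congr_deriv ?_
      field_simp)
  refine key.2.neg.congr_deriv ?_
  rw [intervalIntegral.integral_neg, integral_inv_one_sub_mul hu h0, neg_neg]

theorem exists_isLogBranchAt {x : ℂ} (hx : x ≠ 0) : ∃ ℓ, IsLogBranchAt ℓ x := by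
  refine ⟨fun u => Complex.log (u / x) + Complex.log x, ?_, ?_⟩
  · refine AnalyticAt.add (AnalyticAt.clog (by fun_prop) ?_) analyticAt_const
    rw [div_self hx]
    exact Complex.one_mem_slitPlane
  · filter_upwards [isOpen_ne.mem_nhds hx] with u hu
    rw [Complex.exp_add, Complex.exp_log (div_ne_zero hu hx), Complex.exp_log hx,
      div_mul_cancel₀ _ hx]

theorem IsLogBranchAt.hasDerivAt {ℓ : ℂ → ℂ} {x : ℂ} (h : IsLogBranchAt ℓ x) :
    HasDerivAt ℓ x⁻¹ x := by
  have h1 := h.analyticAt.differentiableAt.hasDerivAt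
  have h2 : HasDerivAt (fun u => Complex.exp (ℓ u)) 1 x :=
    (hasDerivAt_id x).congr_of_eventuallyEq h.exp_eq
  have h3 := h1.cexp.unique h2
  rw [h.exp_eq.self_of_nhds] at h3
  rwa [eq_inv_of_mul_eq_one_right h3] at h1

theorem frequently_im_pos {x : ℂ} (hx : x.im = 0) : ∃ᶠ y in 𝓝 x, 0 < y.im := by
  have ht : Tendsto (fun t : ℝ => x + t * Complex.I) (𝓝[>] 0) (𝓝 x) := by
    have : ContinuousAt (fun t : ℝ => x + t * Complex.I) 0 := by fun_prop
    simpa [ContinuousAt] using this.mono_left nhdsWithin_le_nhds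
  refine ht.frequently (Eventually.frequently ?_)
  filter_upwards [self_mem_nhdsWithin] with t ht
  simpa [hx] using ht

theorem frequently_im_ne_zero (x : ℂ) : ∃ᶠ y in 𝓝 x, y.im ≠ 0 := by
  by_cases hx : x.im = 0
  · exact (frequently_im_pos hx).mono fun y hy => hy.ne'
  · exact (Complex.continuous_im.continuousAt.eventually_ne hx).frequently

/-- Off the cuts `x F'(x) = -log(1 - x) + 2πi m`, and the exponential forgets `m`. Continuity of
`F'` carries the identity to points on a cut. -/
theorem IsDilogBranchAt.exp_mul_deriv {F : ℂ → ℂ} {x : ℂ} (h : IsDilogBranchAt F x) :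
    Complex.exp (x * deriv F x) * (1 - x) = 1 := by
  obtain ⟨m, n, hfreq⟩ := h.eq_dilog
  have hcont : ContinuousAt (fun y => Complex.exp (y * deriv F y) * (1 - y)) x := by
    have := h.analyticAt.deriv.continuousAt
    fun_prop
  have hfreq' : ∃ᶠ y in 𝓝 x, Complex.exp (y * deriv F y) * (1 - y) = 1 := by
    rw [frequently_nhds_iff] at hfreq ⊢
    intro U hxU hU
    obtain ⟨y, hyU, hy⟩ := hfreq U hxU hU
    have hnear : ∀ᶠ y' in 𝓝 y, y' ∈ U ∧ F =ᶠ[𝓝 y'] fun u =>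
        dilog u + 2 * Real.pi * Complex.I * m * Complex.log u + 4 * Real.pi ^ 2 * n :=
      Eventually.and (hU.mem_nhds hyU) hy.eventually_nhds
    -- The point `y` may itself lie on a cut; a nearby non-real point does not.
    obtain ⟨y', him, hy'U, hy'⟩ := ((frequently_im_ne_zero y).and_eventually hnear).exists
    refine ⟨y', hy'U, ?_⟩
    have hy0 : y' ≠ 0 := by rintro rfl; simp at him
    have hs : y' ∈ Complex.slitPlane := Complex.mem_slitPlane_iff.2 (Or.inr him)
    have hs1 : 1 - y' ∈ Complex.slitPlane :=
      Complex.mem_slitPlane_iff.2 (Or.inr (by simpa using him))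
    have hd : HasDerivAt F (-Complex.log (1 - y') / y' +
        2 * Real.pi * Complex.I * m * y'⁻¹) y' :=
      (((hasDerivAt_dilog hs1 hy0).add
        ((Complex.hasDerivAt_log hs).const_mul _)).add_const _).congr_of_eventuallyEq hy'
    rw [hd.deriv]
    have : y' * (-Complex.log (1 - y') / y' + 2 * Real.pi * Complex.I * m * y'⁻¹) =
        -Complex.log (1 - y') + m * (2 * Real.pi * Complex.I) := by
      field_simp
    rw [this, Complex.exp_add, Complex.exp_int_mul_two_pi_mul_I, mul_one, Complex.exp_neg,
      Complex.exp_log (Complex.slitPlane_ne_zero hs1),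
      inv_mul_cancel₀ (Complex.slitPlane_ne_zero hs1)]
  by_contra hne
  exact hfreq' (hcont.eventually_ne hne)

/-- Only real `x > 1` needs work. There a primitive of the continued derivative differs from the
principal value by a constant on the upper bank of the cut. -/
theorem exists_isDilogBranchAt {x : ℂ} (h0 : x ≠ 0) (h1 : x ≠ 1) : ∃ F, IsDilogBranchAt F x := by
  by_cases hs : 1 - x ∈ Complex.slitPlane
  · refine ⟨dilog, ?_, 0, 0, ?_⟩
    · have : ∀ᶠ u in 𝓝 x, DifferentiableAt ℂ dilog u := by
        have hopen : IsOpen {v : ℂ | 1 - v ∈ Complex.slitPlane} :=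
          Complex.isOpen_slitPlane.preimage (by fun_prop)
        filter_upwards [hopen.mem_nhds hs, isOpen_ne.mem_nhds h0] with u hu hu0
        exact (hasDerivAt_dilog hu hu0).differentiableAt
      exact Complex.analyticAt_iff_eventually_differentiableAt.2 this
    · refine Eventually.frequently (Eventually.of_forall fun y => ?_)
      simp
  · obtain ⟨hre', him⟩ : x.re ≥ 1 ∧ x.im = 0 := by
      rw [Complex.mem_slitPlane_iff, not_or] at hs
      simpa using hs
    have hre : 1 < x.re := lt_of_le_of_ne hre' fun h => h1 (Complex.ext h.symm him)
    -- This radius keeps the ball in `Re u > 1`, where `u ≠ 0` and `log(u - 1)` is holomorphic.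
    have hball : ∀ u ∈ Metric.ball x (x.re - 1), 1 < u.re := by
      intro u hu
      rw [Metric.mem_ball, dist_eq_norm] at hu
      have := (abs_le.1 (Complex.abs_re_le_norm (u - x))).1
      rw [Complex.sub_re] at this
      linarith
    have hslit : ∀ u ∈ Metric.ball x (x.re - 1), u - 1 ∈ Complex.slitPlane := fun u hu =>
      Complex.mem_slitPlane_iff.2 (Or.inl (by simpa using hball u hu))
    have hne0 : ∀ u ∈ Metric.ball x (x.re - 1), u ≠ 0 := by
      rintro u hu rfl
      have := hball 0 hu
      norm_num at this
    have hdiff : DifferentiableOn ℂ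
        (fun u => -(Complex.log (u - 1) - Real.pi * Complex.I) / u)
        (Metric.ball x (x.re - 1)) := by
      intro u hu
      have := hslit u hu
      have := hne0 u hu
      refine DifferentiableAt.differentiableWithinAt ?_
      fun_prop (disch := assumption)
    obtain ⟨G, hG⟩ := hdiff.isExactOn_ball
    have hx : x ∈ Metric.ball x (x.re - 1) := Metric.mem_ball_self (by linarith)
    set H : Set ℂ := Metric.ball x (x.re - 1) ∩ {u | 0 < u.im}
    have hHconv : Convex ℝ H := (convex_ball x _).inter (convex_halfSpace_im_gt 0)
    have hHopen : IsOpen H :=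
      Metric.isOpen_ball.inter (isOpen_lt continuous_const Complex.continuous_im)
    have hder : ∀ u ∈ H, HasDerivAt (fun u => dilog u - G u) 0 u := by
      rintro u ⟨hu, hpos⟩
      have hs1 : 1 - u ∈ Complex.slitPlane :=
        Complex.mem_slitPlane_iff.2 (Or.inr (by simpa using ne_of_gt hpos))
      refine ((hasDerivAt_dilog hs1 (hne0 u hu)).sub (hG u hu)).congr_deriv ?_
      have harg : Complex.log (1 - u) = Complex.log (u - 1) - Real.pi * Complex.I := by
        have hi : 0 < (u - 1).im := by simpa using hpos
        rw [← neg_sub u 1, Complex.log, Complex.log, norm_neg,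
          Complex.arg_neg_eq_arg_sub_pi_of_im_pos hi]
        push_cast
        ring
      rw [harg, sub_self]
    have hcl : ∃ᶠ y in 𝓝 x, y ∈ H :=
      ((frequently_im_pos him).and_eventually (Metric.isOpen_ball.mem_nhds hx)).mono
        fun y hy => ⟨hy.2, hy.1⟩
    obtain ⟨c, hc⟩ : ∃ c, ∀ u ∈ H, dilog u - G u = c := by
      obtain ⟨y, hy⟩ := hcl.exists
      exact ⟨_, fun u hu => hHopen.is_const_of_deriv_eq_zero hHconv.isPreconnected
        (fun v hv => (hder v hv).differentiableAt.differentiableWithinAt)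
        (fun v hv => (hder v hv).deriv) hu hy⟩
    refine ⟨fun u => G u + c, ?_, 0, 0, ?_⟩
    · refine AnalyticAt.add (Complex.analyticAt_iff_eventually_differentiableAt.2 ?_)
        analyticAt_const
      filter_upwards [Metric.isOpen_ball.mem_nhds hx] with u hu
      exact (hG u hu).differentiableAt
    · refine hcl.mono fun y hy => ?_
      filter_upwards [hHopen.mem_nhds hy] with u hu
      simp [← hc u hu]

/-! ### The colors around a crossing -/

namespace LinkDiagram

variable {X : Type u} {R : Type v} {D : LinkDiagram X R} {ρ : D.LinkGroup →* PSL2C}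
  {a : D.Arc → Fin 2 → ℂ} {s : R → Fin 2 → ℂ} {p : Fin 2 → ℂ}

theorem det2_left (hs : D.IsRegionColoring a s) (k : X × Strand) :
    det2 (a (D.arc k)) (s (D.left k)) = det2 (a (D.arc k)) (s (D.right k)) := by
  rw [hs.left_eq, det2_quandleOp_right]

variable (D) in
theorem corner_h (j : X) :
    (D.isPositive j = true ∧ D.right (D.side j .h) = D.west j ∧ D.left (D.side j .h) = D.north j) ∨
    (D.isPositive j = false ∧ D.right (D.side j .h) = D.north j ∧
      D.left (D.side j .h) = D.west j) := by
  by_cases hp : D.isPositive j = true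
  · obtain ⟨c1, c2, c3, c4⟩ := D.positive_corners j hp
    left
    simp [side, hp, west, north, c1, c3]
  · have hp' : D.isPositive j = false := by simpa using hp
    obtain ⟨c1, c2, c3, c4⟩ := D.negative_corners j hp'
    right
    simp [side, hp', west, north, c1, c3]

variable (D) in
theorem corner_f (j : X) :
    (D.isPositive j = true ∧ D.right (D.side j .f) = D.south j ∧ D.left (D.side j .f) = D.east j) ∨
    (D.isPositive j = false ∧ D.right (D.side j .f) = D.east j ∧
      D.left (D.side j .f) = D.south j) := by
  by_cases hp : D.isPositive j = true
  · obtain ⟨c1, c2, c3, c4⟩ := D.positive_corners j hp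
    left
    simp [side, hp, south, east, c2, c4]
  · have hp' : D.isPositive j = false := by simpa using hp
    obtain ⟨c1, c2, c3, c4⟩ := D.negative_corners j hp'
    right
    simp [side, hp', south, east, c2, c4]

/-- The values `z_e`, `z_f`, `z_g`, `z_h` at a crossing in terms of the colors `A` and `b` of the
over-strand and of the under-arc to its right and of the colors `W`, `N` of the regions in the west
and north. -/
theorem crossing_values (ha : D.IsArcColoring ρ a) (hs : D.IsRegionColoring a s)
    (hr : ∀ k, det2 (a (D.arc k)) (s (D.right k)) ≠ 0) (j : X) :
    ∃ A b W N : Fin 2 → ℂ, A = a (D.arc (D.side j .e)) ∧ b = a (D.arc (D.side j .h)) ∧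
      s (D.west j) = W ∧ s (D.north j) = N ∧
      s (D.south j) = quandleOp W A ∧ s (D.east j) = quandleOp N A ∧
      (N = quandleOp W b ∨ W = quandleOp N b) ∧
      det2 A W ≠ 0 ∧ det2 A N ≠ 0 ∧ det2 b W ≠ 0 ∧
      ∀ p, D.zSol a s p (D.side j .e) = det2 A p / det2 A W ∧
        D.zSol a s p (D.side j .f) =
          det2 (quandleOp b A) p / det2 (quandleOp b A) (quandleOp W A) ∧
        D.zSol a s p (D.side j .g) = det2 A p / det2 A N ∧
        D.zSol a s p (D.side j .h) = det2 b p / det2 b W := by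
  have hS : s (D.south j) = quandleOp (s (D.west j)) (a (D.arc (D.side j .e))) := hs.left_eq _
  have hE : s (D.east j) = quandleOp (s (D.north j)) (a (D.arc (D.side j .e))) := by
    rw [D.arc_side_e j]
    exact hs.left_eq _
  have hl := hs.left_eq (D.side j .h)
  have hbr := hr (D.side j .h)
  -- The sign of the crossing only decides which of north and west is to the right of the
  -- under-strand. As `det(b, ·)` agrees on both, the formula for `z_h` can always use west, and
  -- both signs are treated together.
  have hN : (s (D.north j) = quandleOp (s (D.west j)) (a (D.arc (D.side j .h))) ∨
      s (D.west j) = quandleOp (s (D.north j)) (a (D.arc (D.side j .h)))) ∧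
      det2 (a (D.arc (D.side j .h))) (s (D.right (D.side j .h))) =
      det2 (a (D.arc (D.side j .h))) (s (D.west j)) := by
    rcases D.corner_h j with ⟨-, h1, h2⟩ | ⟨-, h1, h2⟩ <;> rw [h1, h2] at hl <;> rw [h1]
    · exact ⟨Or.inl hl, rfl⟩
    · exact ⟨Or.inr hl, by rw [hl, det2_quandleOp_right]⟩
  have hf : det2 (a (D.arc (D.side j .f))) (s (D.right (D.side j .f))) =
      det2 (a (D.arc (D.side j .f))) (s (D.south j)) := by
    rcases D.corner_f j with ⟨-, h1, h2⟩ | ⟨-, h1, h2⟩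
    · rw [h1]
    · rw [← h2, det2_left hs]
  refine ⟨_, _, _, _, rfl, rfl, rfl, rfl, hS, hE, hN.1, hr _, ?_, ?_, fun p => ⟨rfl, ?_, ?_, ?_⟩⟩
  · rw [D.arc_side_e j]
    exact hr _
  · rw [← hN.2]
    exact hbr
  · rw [zSol, hf, hS]
    rcases ha.crossing j with h | h <;> rw [h]
    -- The values `z` are even in the arc-color, so the sign in `a_m = ± a_l * a_k` is harmless.
    rw [det2_neg_left, det2_neg_left, neg_div_neg_eq]
  · rw [D.arc_side_e j]
    rfl
  · rw [zSol, hN.2]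

/-- The differences of the values at neighbouring corners of a crossing. -/
theorem crossing_differences (ha : D.IsArcColoring ρ a) (hs : D.IsRegionColoring a s)
    (hr : ∀ k, det2 (a (D.arc k)) (s (D.right k)) ≠ 0) (p : Fin 2 → ℂ) (j : X) :
    ∃ δ μ ν : ℂ, δ = det2 (a (D.arc (D.side j .e))) (a (D.arc (D.side j .h))) ∧ μ ≠ 0 ∧ ν ≠ 0 ∧
      D.zSol a s p (D.side j .e) * μ = D.zSol a s p (D.side j .g) * ν ∧
      (D.zSol a s p (D.side j .e) - D.zSol a s p (D.side j .f)) * μ =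
        δ * det2 (s (D.south j)) p ∧
      (D.zSol a s p (D.side j .e) - D.zSol a s p (D.side j .h)) * μ =
        δ * det2 (s (D.west j)) p ∧
      (D.zSol a s p (D.side j .g) - D.zSol a s p (D.side j .f)) * ν =
        δ * det2 (s (D.east j)) p ∧
      (D.zSol a s p (D.side j .g) - D.zSol a s p (D.side j .h)) * ν =
        δ * det2 (s (D.north j)) p := by
  obtain ⟨A, b, W, N, rfl, rfl, hW, hN, hS, hE, hWN, hAW, hAN, hbW, hz⟩ :=
    crossing_values ha hs hr j
  obtain ⟨he, hf, hg, hh⟩ := hz p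
  rw [hW, hN, hS, hE, he, hf, hg, hh, det2_quandleOp_quandleOp]
  generalize a (D.arc (D.side j .e)) = A at *
  generalize a (D.arc (D.side j .h)) = b at *
  have hbN : det2 b N = det2 b W := by
    rcases hWN with h | h <;> rw [h, det2_quandleOp_right]
  -- These clear the denominators. What remains is Plücker's relation `det(A,p) det(b,W) - det(A,W)
  -- det(b,p) = det(A,b) det(p,W)` and its analogues.
  refine ⟨_, -(det2 A W * det2 b W), -(det2 A N * det2 b W), rfl, by simp [hAW, hbW],
    by simp [hAN, hbW], ?_, ?_, ?_, ?_, ?_⟩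
  · field_simp
  · field_simp
    simp only [quandleOp_eq, det2, Pi.sub_apply, Pi.smul_apply, smul_eq_mul]
    ring
  · field_simp
    simp only [det2]
    ring
  · field_simp
    rw [← hbN]
    simp only [quandleOp_eq, det2, Pi.sub_apply, Pi.smul_apply, smul_eq_mul]
    ring
  · field_simp
    rw [← hbN]
    simp only [det2]
    ring

/-! ### Non-vanishing of the explicit values, and corner factors -/

theorem zSol_ne_zero (ha : D.IsArcColoring ρ a)
    (hr : ∀ k, det2 (a (D.arc k)) (s (D.right k)) ≠ 0) (hp : D.Avoids a s p) (k : X × Strand) :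
    D.zSol a s p k ≠ 0 := by
  refine div_ne_zero ?_ (hr k)
  have h := hp.arcs (D.arc k)
  rwa [ne_comm, Ne, hopf_eq_iff (ha.ne_zero _) hp.ne_zero] at h

theorem det2_region_ne_zero (hs : D.IsRegionColoring a s) (hp : D.Avoids a s p) (r : R) :
    det2 (s r) p ≠ 0 := by
  have h := hp.regions r
  rwa [ne_comm, Ne, hopf_eq_iff (hs.ne_zero _) hp.ne_zero] at h

theorem isDegenerate_iff (ha : D.IsArcColoring ρ a) (j : X) :
    D.IsDegenerate a j ↔ det2 (a (D.arc (D.side j .e))) (a (D.arc (D.side j .h))) = 0 :=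
  hopf_eq_iff (ha.ne_zero _) (ha.ne_zero _)

theorem zSol_eq_of_isDegenerate (ha : D.IsArcColoring ρ a) (hs : D.IsRegionColoring a s)
    (hr : ∀ k, det2 (a (D.arc k)) (s (D.right k)) ≠ 0) {j : X} (hj : D.IsDegenerate a j)
    (c : Corner) : D.zSol a s p (D.side j c) = D.zSol a s p (D.side j .e) := by
  obtain ⟨δ, μ, ν, hδ, hμ, hν, h0, h1, h2, h3, h4⟩ := crossing_differences ha hs hr p j
  rw [← hδ.trans ((isDegenerate_iff ha j).1 hj)] at *
  rw [(isDegenerate_iff ha j).1 hj] at hδ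
  subst hδ
  simp only [zero_mul, mul_eq_zero, hμ, hν, or_false, sub_eq_zero] at h1 h2 h3 h4
  cases c
  · rfl
  · exact h1.symm
  · rw [h3, h1]
  · exact h2.symm

theorem zSol_ratio_ne_one (ha : D.IsArcColoring ρ a) (hs : D.IsRegionColoring a s)
    (hr : ∀ k, det2 (a (D.arc k)) (s (D.right k)) ≠ 0) (hp : D.Avoids a s p) {j : X}
    (hj : ¬ D.IsDegenerate a j) :
    D.zSol a s p (D.side j .f) / D.zSol a s p (D.side j .e) ≠ 1 ∧
    D.zSol a s p (D.side j .g) / D.zSol a s p (D.side j .f) ≠ 1 ∧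
    D.zSol a s p (D.side j .h) / D.zSol a s p (D.side j .g) ≠ 1 ∧
    D.zSol a s p (D.side j .e) / D.zSol a s p (D.side j .h) ≠ 1 ∧
    D.zSol a s p (D.side j .g) / D.zSol a s p (D.side j .e) ≠ 1 ∧
    D.zSol a s p (D.side j .h) / D.zSol a s p (D.side j .f) ≠ 1 := by
  have hd := hj ∘ (isDegenerate_iff ha j).2
  obtain ⟨δ, μ, ν, rfl, hμ, hν, h0, h1, h2, h3, h4⟩ := crossing_differences ha hs hr p j
  obtain ⟨A, b, W, N, rfl, rfl, hW, hN, hS, hE, hWN, hAW, hAN, hbW, hz⟩ :=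
    crossing_values ha hs hr j
  have hz0 := zSol_ne_zero ha hr hp
  have hreg := det2_region_ne_zero hs hp
  have hAp : det2 (a (D.arc (D.side j .e))) p ≠ 0 := by
    have h := hp.arcs (D.arc (D.side j .e))
    rwa [ne_comm, Ne, hopf_eq_iff (ha.ne_zero _) hp.ne_zero] at h
  simp only [Ne, div_eq_one_iff_eq (hz0 _)]
  refine ⟨fun h => ?_, fun h => ?_, fun h => ?_, fun h => ?_, fun h => ?_, fun h => ?_⟩
  · rw [h, sub_self, zero_mul] at h1
    exact mul_ne_zero hd (hreg _) h1.symm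
  · rw [h, sub_self, zero_mul] at h3
    exact mul_ne_zero hd (hreg _) h3.symm
  · rw [h, sub_self, zero_mul] at h4
    exact mul_ne_zero hd (hreg _) h4.symm
  · rw [h, sub_self, zero_mul] at h2
    exact mul_ne_zero hd (hreg _) h2.symm
  -- Opposite corners do not enclose one region. Here `z_g = z_e` means `det(A, N) = det(A, W)`,
  -- hence `det(A, b) det(b, W) = 0`; below, `z_h = z_f` gives `det(A, b) det(A, p) = 0`.
  · rw [(hz p).1, (hz p).2.2.1, div_eq_div_iff hAN hAW] at h
    have h' := mul_left_cancel₀ hAp h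
    refine mul_ne_zero hd hbW ?_
    rcases hWN with rfl | rfl
    · rw [quandleOp_eq, det2_sub_right, det2_smul_right] at h'
      linear_combination h'
    · rw [det2_quandleOp_right]
      rw [quandleOp_eq, det2_sub_right, det2_smul_right] at h'
      linear_combination -h'
  · rw [(hz p).2.1, (hz p).2.2.2, det2_quandleOp_quandleOp, div_left_inj' hbW] at h
    refine mul_ne_zero hd hAp ?_
    simp only [quandleOp_eq, det2, Pi.sub_apply, Pi.smul_apply, smul_eq_mul] at h ⊢
    linear_combination h

/-- The quotients of region-colors that give the values `w⁽⁰⁾`, at an arbitrary crossing. -/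
def cornerRatio (D : LinkDiagram X R) (s : R → Fin 2 → ℂ) (p : Fin 2 → ℂ) (j : X) (c : Corner) :
    ℂ :=
  det2 (s (D.wNum j c)) p / det2 (s (D.wDen j c)) p

theorem cornerRatio_ne_zero (hs : D.IsRegionColoring a s) (hp : D.Avoids a s p) (j : X)
    (c : Corner) : D.cornerRatio s p j c ≠ 0 :=
  div_ne_zero (det2_region_ne_zero hs hp _) (det2_region_ne_zero hs hp _)

/-- The contribution of a corner to the exponentiated derivative of the potential with respect to
the side at the corner. -/
def cornerFactor (D : LinkDiagram X R) (s : R → Fin 2 → ℂ) (p : Fin 2 → ℂ) (j : X) :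
    Corner → ℂ
  | .e => (D.cornerRatio s p j .e)⁻¹
  | .f => D.cornerRatio s p j .f
  | .g => (D.cornerRatio s p j .g)⁻¹
  | .h => D.cornerRatio s p j .h

/-- Since `μ z_e = ν z_g`, the four numbers `1 - z_c / z_c'` are the `det(r, p)` of the four regions
times the common factor `δ / (μ z_e)`, which cancels in the quotients. -/
theorem cornerFactor_eq (ha : D.IsArcColoring ρ a) (hs : D.IsRegionColoring a s)
    (hr : ∀ k, det2 (a (D.arc k)) (s (D.right k)) ≠ 0) (hp : D.Avoids a s p) {j : X}
    (hj : ¬ D.IsDegenerate a j) :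
    (1 - D.zSol a s p (D.side j .f) / D.zSol a s p (D.side j .e)) /
        (1 - D.zSol a s p (D.side j .h) / D.zSol a s p (D.side j .e)) = D.cornerFactor s p j .e ∧
    (1 - D.zSol a s p (D.side j .f) / D.zSol a s p (D.side j .g)) /
        (1 - D.zSol a s p (D.side j .f) / D.zSol a s p (D.side j .e)) = D.cornerFactor s p j .f ∧
    (1 - D.zSol a s p (D.side j .h) / D.zSol a s p (D.side j .g)) /
        (1 - D.zSol a s p (D.side j .f) / D.zSol a s p (D.side j .g)) = D.cornerFactor s p j .g ∧
    (1 - D.zSol a s p (D.side j .h) / D.zSol a s p (D.side j .e)) /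
        (1 - D.zSol a s p (D.side j .h) / D.zSol a s p (D.side j .g)) = D.cornerFactor s p j .h := by
  have hd := hj ∘ (isDegenerate_iff ha j).2
  obtain ⟨δ, μ, ν, rfl, hμ, hν, h0, h1, h2, h3, h4⟩ := crossing_differences ha hs hr p j
  have hz0 := zSol_ne_zero ha hr hp
  have he := hz0 (D.side j .e)
  have hg := hz0 (D.side j .g)
  have hreg := det2_region_ne_zero hs hp
  simp only [cornerFactor, cornerRatio, wNum, wDen]
  have hS := hreg (D.south j)
  have hW := hreg (D.west j)
  have hE := hreg (D.east j)
  have hN := hreg (D.north j)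
  generalize D.zSol a s p (D.side j .e) = ze at *
  generalize D.zSol a s p (D.side j .f) = zf at *
  generalize D.zSol a s p (D.side j .g) = zg at *
  generalize D.zSol a s p (D.side j .h) = zh at *
  generalize det2 (s (D.south j)) p = S at *
  generalize det2 (s (D.west j)) p = W at *
  generalize det2 (s (D.east j)) p = E at *
  generalize det2 (s (D.north j)) p = N at *
  generalize det2 (a (D.arc (D.side j .e))) (a (D.arc (D.side j .h))) = δ at *
  have hd : δ ≠ 0 := hd
  have e1 : 1 - zf / ze = δ * S / (μ * ze) := by
    field_simp
    linear_combination h1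
  have e2 : 1 - zh / ze = δ * W / (μ * ze) := by
    field_simp
    linear_combination h2
  have e3 : 1 - zf / zg = δ * E / (μ * ze) := by
    rw [mul_comm μ, h0]
    field_simp
    linear_combination h3
  have e4 : 1 - zh / zg = δ * N / (μ * ze) := by
    rw [mul_comm μ, h0]
    field_simp
    linear_combination h4
  rw [e1, e2, e3, e4]
  refine ⟨?_, ?_, ?_, ?_⟩ <;> field_simp

/-- The quotient `det(s * a, p) / det(s, p)` of the region-colors on the two sides of a side. -/
def sideRatio (D : LinkDiagram X R) (s : R → Fin 2 → ℂ) (p : Fin 2 → ℂ) (k : X × Strand) : ℂ :=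
  det2 (s (D.left k)) p / det2 (s (D.right k)) p

theorem sideRatio_ne_zero (hs : D.IsRegionColoring a s) (hp : D.Avoids a s p) (k : X × Strand) :
    D.sideRatio s p k ≠ 0 :=
  div_ne_zero (det2_region_ne_zero hs hp _) (det2_region_ne_zero hs hp _)

theorem cornerRatio_e (j : X) : D.cornerRatio s p j .e = (D.sideRatio s p (D.side j .e))⁻¹ := by
  simp only [cornerRatio, sideRatio, inv_div, wNum, wDen, west, south]

theorem cornerRatio_g (j : X) : D.cornerRatio s p j .g = D.sideRatio s p (D.side j .g) := rfl

theorem cornerRatio_f_of_positive {j : X} (hj : D.isPositive j = true) :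
    D.cornerRatio s p j .f = D.sideRatio s p (D.side j .f) := by
  rcases D.corner_f j with ⟨-, h1, h2⟩ | ⟨h0, -⟩
  · rw [cornerRatio, sideRatio, h1, h2, wNum, wDen]
  · simp [hj] at h0

theorem cornerRatio_f_of_negative {j : X} (hj : D.isPositive j = false) :
    D.cornerRatio s p j .f = (D.sideRatio s p (D.side j .f))⁻¹ := by
  rcases D.corner_f j with ⟨h0, -⟩ | ⟨-, h1, h2⟩
  · simp [hj] at h0
  · rw [cornerRatio, sideRatio, h1, h2, wNum, wDen, inv_div]

theorem cornerRatio_h_of_positive {j : X} (hj : D.isPositive j = true) :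
    D.cornerRatio s p j .h = (D.sideRatio s p (D.side j .h))⁻¹ := by
  rcases D.corner_h j with ⟨-, h1, h2⟩ | ⟨h0, -⟩
  · rw [cornerRatio, sideRatio, h1, h2, wNum, wDen, inv_div]
  · simp [hj] at h0

theorem cornerRatio_h_of_negative {j : X} (hj : D.isPositive j = false) :
    D.cornerRatio s p j .h = D.sideRatio s p (D.side j .h) := by
  rcases D.corner_h j with ⟨h0, -⟩ | ⟨-, h1, h2⟩
  · simp [hj] at h0
  · rw [cornerRatio, sideRatio, h1, h2, wNum, wDen]

open Classical in
/-- A side contributes inverse factors at its two ends. -/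
theorem prod_cornerFactor_eq_one [Fintype X] (hs : D.IsRegionColoring a s) (hp : D.Avoids a s p)
    (k : X × Strand) :
    ∏ j : X, ((if D.side j .e = k then D.cornerFactor s p j .e else 1) *
      (if D.side j .f = k then D.cornerFactor s p j .f else 1) *
      (if D.side j .g = k then D.cornerFactor s p j .g else 1) *
      (if D.side j .h = k then D.cornerFactor s p j .h else 1)) = 1 := by
  have hj : ∀ j : X, ((if D.side j .e = k then D.cornerFactor s p j .e else 1) *
      (if D.side j .f = k then D.cornerFactor s p j .f else 1) *
      (if D.side j .g = k then D.cornerFactor s p j .g else 1) *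
      (if D.side j .h = k then D.cornerFactor s p j .h else 1)) =
      (∏ t : Strand, if (j, t) = k then D.sideRatio s p (j, t) else 1) *
      ∏ t : Strand, if D.next.symm (j, t) = k then
        (D.sideRatio s p (D.next.symm (j, t)))⁻¹ else 1 := by
    intro j
    obtain ⟨I, hI⟩ : ∃ I : X × Strand → ℂ → ℂ, ∀ x c, (if x = k then c else 1) = I x c :=
      ⟨_, fun _ _ => rfl⟩
    rw [Strand.prod_eq, Strand.prod_eq]
    simp only [hI, cornerFactor, cornerRatio_e, cornerRatio_g, inv_inv]
    by_cases h : D.isPositive j = true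
    · rw [cornerRatio_f_of_positive h, cornerRatio_h_of_positive h]
      simp only [side, h, if_true]
      ring
    · have h' : D.isPositive j = false := by simpa using h
      rw [cornerRatio_f_of_negative h', cornerRatio_h_of_negative h']
      simp only [side, h', if_false, Bool.false_eq_true]
      ring
  rw [Finset.prod_congr rfl fun j _ => hj j, Finset.prod_mul_distrib,
    ← Fintype.prod_prod_type' (f := fun j t =>
      if (j, t) = k then D.sideRatio s p (j, t) else 1),
    ← Fintype.prod_prod_type' (f := fun j t => if D.next.symm (j, t) = k then
        (D.sideRatio s p (D.next.symm (j, t)))⁻¹ else 1)]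
  -- Every side is outgoing at exactly one place and incoming at exactly one place, so after
  -- reindexing only `k` survives, once with each exponent.
  rw [Equiv.prod_comp D.next.symm (fun x => if x = k then (D.sideRatio s p x)⁻¹ else 1)]
  simp only [Prod.mk.eta]
  rw [Finset.prod_ite_eq' , Finset.prod_ite_eq']
  simp [sideRatio_ne_zero hs hp]

theorem cornerRatio_mul (hs : D.IsRegionColoring a s) (hp : D.Avoids a s p) (j : X) :
    D.cornerRatio s p j .e * D.cornerRatio s p j .g =
      D.cornerRatio s p j .f * D.cornerRatio s p j .h := by
  have hreg := det2_region_ne_zero hs hp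
  simp only [cornerRatio, wNum, wDen]
  have hS := hreg (D.south j)
  have hN := hreg (D.north j)
  field_simp

/-- Every corner ratio is a side ratio or its inverse, and `det(s * a, p) - det(s, p) = -det(a, s)
det(a, p)`. -/
theorem cornerRatio_ne_one (ha : D.IsArcColoring ρ a) (hs : D.IsRegionColoring a s)
    (hr : ∀ k, det2 (a (D.arc k)) (s (D.right k)) ≠ 0) (hp : D.Avoids a s p) (j : X)
    (c : Corner) : D.cornerRatio s p j c ≠ 1 := by
  have hside : ∀ k, D.sideRatio s p k ≠ 1 := by
    intro k h
    rw [sideRatio, div_eq_one_iff_eq (det2_region_ne_zero hs hp _), hs.left_eq] at h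
    have hap : det2 (a (D.arc k)) p ≠ 0 := by
      have h := hp.arcs (D.arc k)
      rwa [ne_comm, Ne, hopf_eq_iff (ha.ne_zero _) hp.ne_zero] at h
    refine mul_ne_zero (hr k) hap ?_
    simp only [quandleOp_eq, det2, Pi.sub_apply, Pi.smul_apply, smul_eq_mul] at h ⊢
    linear_combination -h
  by_cases h : D.isPositive j = true
  · cases c
    · simpa [cornerRatio_e] using hside _
    · simpa [cornerRatio_f_of_positive h] using hside _
    · simpa [cornerRatio_g] using hside _
    · simpa [cornerRatio_h_of_positive h] using hside _
  · have h' : D.isPositive j = false := by simpa using h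
    cases c
    · simpa [cornerRatio_e] using hside _
    · simpa [cornerRatio_f_of_negative h'] using hside _
    · simpa [cornerRatio_g] using hside _
    · simpa [cornerRatio_h_of_negative h'] using hside _

/-- A fixed side would be a whole component, and it would always arrive on the same strand. -/
theorem EveryComponentOverAndUnder.next_ne (hD : D.EveryComponentOverAndUnder) (k : X × Strand) :
    D.next.symm k ≠ k := by
  intro h
  have h1 : D.next k = k := ((Equiv.symm_apply_eq _).1 h).symm
  have hpow : ∀ n : ℕ, (D.next ^ n) k = k := fun n =>
    Equiv.Perm.pow_apply_eq_self_of_apply_eq_self h1 n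
  obtain ⟨⟨n, hn⟩, m, hm⟩ := hD k
  rw [hpow] at hn hm
  rw [hn] at hm
  cases hm

/-- At a kink, the values at the two corners that belong to the same side agree. -/
theorem cornerRatio_eq_of_side_eq (hD : D.EveryComponentOverAndUnder) (j : X) :
    ∀ c c' : Corner, D.side j c = D.side j c' →
      D.cornerRatio s p j c = D.cornerRatio s p j c' := by
  have hne := hD.next_ne
  by_cases h : D.isPositive j = true
  · have h1 : D.side j .e ≠ D.side j .f := by simp [side, h]
    -- The coincidences `e = g` and `f = h` would force inverse values on one side; they are
    -- excluded because no side continues itself. The true kinks `e = h` and `f = g` have matching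
    -- exponents.
    have h2 : D.side j .e ≠ D.side j .g := (hne _).symm
    have h3 : D.side j .f ≠ D.side j .h := by simpa [side, h] using (hne _).symm
    have h4 : D.side j .g ≠ D.side j .h := by simp [side, h]
    have h5 : D.side j .e = D.side j .h → D.cornerRatio s p j .e = D.cornerRatio s p j .h :=
      fun hk => by rw [cornerRatio_e, cornerRatio_h_of_positive h, hk]
    have h6 : D.side j .f = D.side j .g → D.cornerRatio s p j .f = D.cornerRatio s p j .g :=
      fun hk => by rw [cornerRatio_g, cornerRatio_f_of_positive h, hk]
    rintro (_ | _ | _ | _) (_ | _ | _ | _) hk <;> grind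
  · have h' : D.isPositive j = false := by simpa using h
    have h1 : D.side j .e ≠ D.side j .h := by simp [side, h']
    have h2 : D.side j .e ≠ D.side j .g := (hne _).symm
    have h3 : D.side j .f ≠ D.side j .h := by simpa [side, h'] using hne _
    have h4 : D.side j .f ≠ D.side j .g := by simp [side, h']
    have h5 : D.side j .e = D.side j .f → D.cornerRatio s p j .e = D.cornerRatio s p j .f :=
      fun hk => by rw [cornerRatio_e, cornerRatio_f_of_negative h', hk]
    have h6 : D.side j .g = D.side j .h → D.cornerRatio s p j .g = D.cornerRatio s p j .h :=
      fun hk => by rw [cornerRatio_g, cornerRatio_h_of_negative h', hk]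
    rintro (_ | _ | _ | _) (_ | _ | _ | _) hk <;> grind

end LinkDiagram

/-! ### The derivation `t d/dt` -/

/-- `f` is differentiable at `t`, with `t f'(t) = e`. -/
def HasEulerDerivAt (f : ℂ → ℂ) (e t : ℂ) : Prop := ∃ f', HasDerivAt f f' t ∧ t * f' = e

namespace HasEulerDerivAt

variable {f g : ℂ → ℂ} {e e' t : ℂ}

theorem mul_deriv (hf : HasEulerDerivAt f e t) : t * deriv f t = e := by
  obtain ⟨f', hf, rfl⟩ := hf
  rw [hf.deriv]

theorem congr_value (hf : HasEulerDerivAt f e t) (h : e = e') : HasEulerDerivAt f e' t := h ▸ hf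

theorem const (c t : ℂ) : HasEulerDerivAt (fun _ => c) 0 t :=
  ⟨0, hasDerivAt_const t c, mul_zero t⟩

theorem id (t : ℂ) : HasEulerDerivAt (fun u => u) t t := ⟨1, hasDerivAt_id t, mul_one t⟩

theorem add (hf : HasEulerDerivAt f e t) (hg : HasEulerDerivAt g e' t) :
    HasEulerDerivAt (fun u => f u + g u) (e + e') t := by
  obtain ⟨f', hf, rfl⟩ := hf
  obtain ⟨g', hg, rfl⟩ := hg
  exact ⟨_, hf.add hg, mul_add _ _ _⟩

theorem sub (hf : HasEulerDerivAt f e t) (hg : HasEulerDerivAt g e' t) :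
    HasEulerDerivAt (fun u => f u - g u) (e - e') t := by
  obtain ⟨f', hf, rfl⟩ := hf
  obtain ⟨g', hg, rfl⟩ := hg
  exact ⟨_, hf.sub hg, mul_sub _ _ _⟩

theorem neg (hf : HasEulerDerivAt f e t) : HasEulerDerivAt (fun u => -f u) (-e) t := by
  obtain ⟨f', hf, rfl⟩ := hf
  exact ⟨_, hf.neg, mul_neg _ _⟩

theorem mul (hf : HasEulerDerivAt f e t) (hg : HasEulerDerivAt g e' t) :
    HasEulerDerivAt (fun u => f u * g u) (e * g t + f t * e') t := by
  obtain ⟨f', hf, rfl⟩ := hf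
  obtain ⟨g', hg, rfl⟩ := hg
  exact ⟨_, hf.mul hg, by ring⟩

theorem sum {ι : Type*} [Fintype ι] {f : ι → ℂ → ℂ} {e : ι → ℂ}
    (h : ∀ i, HasEulerDerivAt (f i) (e i) t) :
    HasEulerDerivAt (fun u => ∑ i, f i u) (∑ i, e i) t := by
  choose f' hf he using h
  refine ⟨∑ i, f' i, HasDerivAt.fun_sum fun i _ => hf i, ?_⟩
  rw [Finset.mul_sum]
  exact Finset.sum_congr rfl fun i _ => he i

/-- The logarithmic derivative of a product. -/
theorem mul_degree {m n : ℂ} (hf : HasEulerDerivAt f (m * f t) t)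
    (hg : HasEulerDerivAt g (n * g t) t) :
    HasEulerDerivAt (fun u => f u * g u) ((m + n) * (f t * g t)) t :=
  (hf.mul hg).congr_value (by ring)

/-- The logarithmic derivative of a quotient. -/
theorem div_degree {m n : ℂ} (hf : HasEulerDerivAt f (m * f t) t)
    (hg : HasEulerDerivAt g (n * g t) t) (h0 : g t ≠ 0) :
    HasEulerDerivAt (fun u => f u / g u) ((m - n) * (f t / g t)) t := by
  obtain ⟨f', hf, hf'⟩ := hf
  obtain ⟨g', hg, hg'⟩ := hg
  refine ⟨_, hf.div hg h0, ?_⟩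
  field_simp
  linear_combination g t * hf' - f t * hg'

/-- The chain rule along a function with logarithmic derivative `n`. -/
theorem comp_degree {n ℓ' : ℂ} {ℓ : ℂ → ℂ} (hf : HasEulerDerivAt f (n * f t) t)
    (hℓ : HasDerivAt ℓ ℓ' (f t)) : HasEulerDerivAt (fun u => ℓ (f u)) (n * (f t * ℓ')) t := by
  obtain ⟨f', hf, hf'⟩ := hf
  refine ⟨_, hℓ.comp t hf, ?_⟩
  linear_combination ℓ' * hf'

end HasEulerDerivAt

/-- If `f` is homogeneous of degree `n` to first order at `t`, then `t d/dt log f = n`, whatever the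
branch. -/
theorem IsLogBranchAt.hasEulerDerivAt {f ℓ : ℂ → ℂ} {n t x : ℂ} (hℓ : IsLogBranchAt ℓ x)
    (hf : HasEulerDerivAt f (n * f t) t) (hx : f t = x) (h0 : x ≠ 0) :
    HasEulerDerivAt (fun u => ℓ (f u)) n t := by
  subst hx
  exact (hf.comp_degree hℓ.hasDerivAt).congr_value (by field_simp)

theorem exp_ite_mul (P : Prop) [Decidable P] (y : ℂ) :
    Complex.exp ((if P then 1 else 0) * y) = if P then Complex.exp y else 1 := by
  split_ifs <;> simp

namespace LinkDiagram

variable {X : Type u} {R : Type v} {D : LinkDiagram X R} {ρ : D.LinkGroup →* PSL2C}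
  {a : D.Arc → Fin 2 → ℂ} {s : R → Fin 2 → ℂ} {p : Fin 2 → ℂ}

theorem exists_potentialBranch {z : D.ZVal} {w : D.WVal a} (hz : ∀ k, z k ≠ 0)
    (hz' : ∀ j, ¬ D.IsDegenerate a j → ∀ c ∈ ({.f, .h} : Set Corner),
      ∀ c' ∈ ({.e, .g} : Set Corner), z (D.side j c) / z (D.side j c') ≠ 1)
    (hw : ∀ j c, D.wEff j.1 (w j) c ≠ 0) : Nonempty (D.PotentialBranch a z w) := by
  classical
  let dl : ℂ → ℂ → ℂ := fun x => if h : x ≠ 0 ∧ x ≠ 1 then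
    (exists_isDilogBranchAt h.1 h.2).choose else 0
  have hdl : ∀ x, x ≠ 0 → x ≠ 1 → IsDilogBranchAt (dl x) x := by
    intro x h0 h1
    simp only [dl, dif_pos (show x ≠ 0 ∧ x ≠ 1 from ⟨h0, h1⟩)]
    exact (exists_isDilogBranchAt h0 h1).choose_spec
  let lg : ℂ → ℂ → ℂ := fun x => if h : x ≠ 0 then (exists_isLogBranchAt h).choose else 0
  have hlg : ∀ x, x ≠ 0 → IsLogBranchAt (lg x) x := by
    intro x h0
    simp only [lg, dif_pos h0]
    exact (exists_isLogBranchAt h0).choose_spec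
  exact ⟨{
    li j c c' := dl (z (D.side j c) / z (D.side j c'))
    logz j c := lg (z (D.side j c))
    logw j c := if h : D.IsDegenerate a j then lg (D.wEff j (w ⟨j, h⟩) c) else 0
    li_branch j hj c hc c' hc' := hdl _ (div_ne_zero (hz _) (hz _)) (hz' j hj c hc c' hc')
    logz_branch j hj c := hlg _ (hz _)
    logw_branch j hj c := by
      rw [dif_pos hj]
      exact hlg _ (hw ⟨j, hj⟩ c) }⟩

theorem wEff_eq {j : X} {w : Corner → ℂ} (h0 : ∀ c, w c ≠ 0)
    (hw : w .e * w .g = w .f * w .h) (c : Corner) : D.wEff j w c = w c := by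
  have hf := h0 .f
  have hh := h0 .h
  cases c <;> simp only [wEff] <;> split_ifs
  · rw [hw]; field_simp
  · rfl
  · rfl
  · rw [hw]; field_simp

open Classical in
theorem hasEulerDerivAt_update (z : D.ZVal) (k k' : X × Strand) :
    HasEulerDerivAt (fun t => Function.update z k t k')
      ((if k' = k then 1 else 0) * Function.update z k (z k) k') (z k) := by
  by_cases h : k' = k
  · subst h
    simpa using HasEulerDerivAt.id (z k')
  · simpa [h] using HasEulerDerivAt.const (z k') (z k)

/-! ### Derivatives with respect to the side variables -/

section SideEquations

variable {z : D.ZVal} {w : D.WVal a} (B : D.PotentialBranch a z w)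

-- The number `L` does not depend on the side `k`, which enters only through the degree of `z_c /
-- z_c'`. The degree is 0 also when both corners lie on `k`.
open Classical in
theorem hasEulerDerivAt_li {j : X} (hj : ¬ D.IsDegenerate a j) (hz : ∀ k, z k ≠ 0)
    {c c' : Corner} (hc : c ∈ ({.f, .h} : Set Corner)) (hc' : c' ∈ ({.e, .g} : Set Corner)) :
    ∃ L, Complex.exp L * (1 - z (D.side j c) / z (D.side j c')) = 1 ∧ ∀ k, HasEulerDerivAt
      (fun t => B.li j c c' (Function.update z k t (D.side j c) /
        Function.update z k t (D.side j c')))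
      (((if D.side j c = k then 1 else 0) - (if D.side j c' = k then 1 else 0)) * L) (z k) := by
  have hb := B.li_branch j hj c hc c' hc'
  refine ⟨_, hb.exp_mul_deriv, fun k => ?_⟩
  have hd := (hasEulerDerivAt_update z k (D.side j c)).div_degree
    (hasEulerDerivAt_update z k (D.side j c')) (by rw [Function.update_eq_self]; exact hz _)
  have hd' := hd.comp_degree (ℓ := B.li j c c') (ℓ' := deriv (B.li j c c')
      (z (D.side j c) / z (D.side j c'))) (by
    rw [Function.update_eq_self]
    exact hb.analyticAt.differentiableAt.hasDerivAt)
  rw [Function.update_eq_self] at hd'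
  exact hd'

-- The factors are indexed by corners and not by sides, so a side occurring at two corners simply
-- collects two of them.
open Classical in
theorem exists_hasEulerDerivAt_nondegTerm {j : X} (hj : ¬ D.IsDegenerate a j)
    (hz : ∀ k, z k ≠ 0) (k : X × Strand) :
    ∃ e, HasEulerDerivAt (fun t => B.nondegTerm j (Function.update z k t)) e (z k) ∧
      Complex.exp e =
        (if D.side j .e = k then (1 - z (D.side j .f) / z (D.side j .e)) /
          (1 - z (D.side j .h) / z (D.side j .e)) else 1) *
        (if D.side j .f = k then (1 - z (D.side j .f) / z (D.side j .g)) /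
          (1 - z (D.side j .f) / z (D.side j .e)) else 1) *
        (if D.side j .g = k then (1 - z (D.side j .h) / z (D.side j .g)) /
          (1 - z (D.side j .f) / z (D.side j .g)) else 1) *
        (if D.side j .h = k then (1 - z (D.side j .h) / z (D.side j .e)) /
          (1 - z (D.side j .h) / z (D.side j .g)) else 1) := by
  obtain ⟨Lfe, hfe, dfe⟩ := hasEulerDerivAt_li B hj hz (c := .f) (c' := .e) (by simp) (by simp)
  obtain ⟨Lfg, hfg, dfg⟩ := hasEulerDerivAt_li B hj hz (c := .f) (c' := .g) (by simp) (by simp)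
  obtain ⟨Lhg, hhg, dhg⟩ := hasEulerDerivAt_li B hj hz (c := .h) (c' := .g) (by simp) (by simp)
  obtain ⟨Lhe, hhe, dhe⟩ := hasEulerDerivAt_li B hj hz (c := .h) (c' := .e) (by simp) (by simp)
  refine ⟨_, (((dfe k).sub (dfg k)).add (dhg k)).sub (dhe k), ?_⟩
  rw [eq_inv_of_mul_eq_one_right hfe, eq_inv_of_mul_eq_one_right hfg,
    eq_inv_of_mul_eq_one_right hhg, eq_inv_of_mul_eq_one_right hhe]
  have hquot : ∀ L L' : ℂ, (Complex.exp L)⁻¹ / (Complex.exp L')⁻¹ = Complex.exp (L' - L) := by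
    intro L L'
    rw [Complex.exp_sub]
    field_simp
  simp only [hquot, ← exp_ite_mul, ← Complex.exp_add]
  congr 1
  ring

open Classical in
theorem exists_hasEulerDerivAt_degTerm {j : X} (hj : D.IsDegenerate a j)
    (hz : ∀ k, z k ≠ 0) (h0 : ∀ c, w ⟨j, hj⟩ c ≠ 0)
    (hw : w ⟨j, hj⟩ .e * w ⟨j, hj⟩ .g = w ⟨j, hj⟩ .f * w ⟨j, hj⟩ .h) (k : X × Strand) :
    ∃ e, HasEulerDerivAt (fun t => B.degTerm j (Function.update z k t) (w ⟨j, hj⟩)) e (z k) ∧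
      Complex.exp e =
        (if D.side j .e = k then (w ⟨j, hj⟩ .e)⁻¹ else 1) *
        (if D.side j .f = k then w ⟨j, hj⟩ .f else 1) *
        (if D.side j .g = k then (w ⟨j, hj⟩ .g)⁻¹ else 1) *
        (if D.side j .h = k then w ⟨j, hj⟩ .h else 1) := by
  have hexp : ∀ c, w ⟨j, hj⟩ c = Complex.exp (B.logw j c (D.wEff j (w ⟨j, hj⟩) c)) := fun c =>
    ((B.logw_branch j hj c).exp_eq.self_of_nhds.trans (wEff_eq h0 hw c)).symm
  have hd : ∀ c, HasEulerDerivAt (fun t => B.logw j c (D.wEff j (w ⟨j, hj⟩) c) *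
      B.logz j c (Function.update z k t (D.side j c)))
      ((if D.side j c = k then 1 else 0) * B.logw j c (D.wEff j (w ⟨j, hj⟩) c)) (z k) := by
    intro c
    exact ((HasEulerDerivAt.const _ _).mul ((B.logz_branch j hj c).hasEulerDerivAt
      (hasEulerDerivAt_update z k (D.side j c)) (by rw [Function.update_eq_self])
      (hz _))).congr_value (by ring)
  refine ⟨_, (((hd .e).neg.add (hd .f)).sub (hd .g)).add (hd .h), ?_⟩
  simp only [hexp, ← Complex.exp_neg, ← exp_ite_mul, ← Complex.exp_add]
  congr 1
  ring

end SideEquations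

/-! ### Derivatives with respect to the variables of a degenerate crossing -/

section CrossingEquations

variable {z : D.ZVal} {w : D.WVal a}

open Classical in
/-- Each of the four variables at a degenerate crossing is homogeneous in the variables of a side,
and the degrees satisfy the linearized relation. -/
theorem exists_degree_wEff {j : X} {v : Corner → ℂ} (h0 : ∀ c, v c ≠ 0) (c₀ : Corner) :
    ∃ n : Corner → ℤ, n .e + n .g = n .f + n .h ∧ ∀ c, HasEulerDerivAt
      (fun t => D.wEff j (fun c => if D.side j c = D.side j c₀ then t else v c) c)
      (n c * D.wEff j (fun c => if D.side j c = D.side j c₀ then v c₀ else v c) c) (v c₀) := by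
  let χ : Corner → ℤ := fun c => if D.side j c = D.side j c₀ then 1 else 0
  have hχ : ∀ c, HasEulerDerivAt (fun t => if D.side j c = D.side j c₀ then t else v c)
      (χ c * (if D.side j c = D.side j c₀ then v c₀ else v c)) (v c₀) := by
    intro c
    by_cases h : D.side j c = D.side j c₀
    · simpa [χ, h] using HasEulerDerivAt.id (v c₀)
    · simpa [χ, h] using HasEulerDerivAt.const (v c) (v c₀)
  have hne : ∀ c, (if D.side j c = D.side j c₀ then v c₀ else v c) ≠ 0 := by
    intro c
    split_ifs <;> exact h0 _
  by_cases hk : ∃ c, c ≠ .h ∧ D.side j c = D.side j .h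
  · refine ⟨fun | .e => χ .e | .f => χ .e + χ .g - χ .h | .g => χ .g | .h => χ .h, by ring, ?_⟩
    rintro (_ | _ | _ | _)
    · exact hχ .e
    · simp only [wEff, if_pos hk]
      push_cast
      exact ((hχ .e).mul_degree (hχ .g)).div_degree (hχ .h) (hne .h)
    · exact hχ .g
    · simp only [wEff, if_pos hk]
      exact hχ .h
  · refine ⟨fun | .e => χ .e | .f => χ .f | .g => χ .g | .h => χ .e + χ .g - χ .f, by ring, ?_⟩
    rintro (_ | _ | _ | _)
    · exact hχ .e
    · simp only [wEff, if_neg hk]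
      exact hχ .f
    · exact hχ .g
    · simp only [wEff, if_neg hk]
      push_cast
      exact ((hχ .e).mul_degree (hχ .g)).div_degree (hχ .f) (hne .f)

-- The exponential of the derivative is the common value of the four `z` to the power `-n_e + n_f -
-- n_g + n_h = 0`.
open Classical in
theorem exists_hasEulerDerivAt_degTerm_setW (B : D.PotentialBranch a z w) (hz : ∀ k, z k ≠ 0)
    (j : {j : X // D.IsDegenerate a j}) (hzj : ∀ c, z (D.side j c) = z (D.side j .e))
    (h0 : ∀ c, w j c ≠ 0) (hw : w j .e * w j .g = w j .f * w j .h)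
    (hside : ∀ c c', D.side j c = D.side j c' → w j c = w j c') (c₀ : Corner) :
    ∃ e, HasEulerDerivAt (fun t => B.degTerm j z (D.setW a w j (D.side j c₀) t j)) e (w j c₀) ∧
      Complex.exp e = 1 := by
  obtain ⟨n, hn, hd⟩ := exists_degree_wEff h0 c₀
  have hself : (fun c => if D.side j c = D.side j c₀ then w j c₀ else w j c) = w j := by
    funext c
    split_ifs with h
    · exact (hside _ _ h).symm
    · rfl
  have hexp : ∀ c, Complex.exp (B.logz j c (z (D.side j c))) = z (D.side j .e) := fun c =>
    (B.logz_branch j j.2 c).exp_eq.self_of_nhds.trans (hzj c)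
  have hlog : ∀ c, HasEulerDerivAt (fun t => B.logw j c (D.wEff j
      (fun c => if D.side j c = D.side j c₀ then t else w j c) c) * B.logz j c (z (D.side j c)))
      (n c * B.logz j c (z (D.side j c))) (w j c₀) := by
    intro c
    refine (((B.logw_branch j j.2 c).hasEulerDerivAt (hd c) (by rw [hself]) ?_).mul
      (HasEulerDerivAt.const _ _)).congr_value (by ring)
    rw [wEff_eq h0 hw]
    exact h0 c
  refine ⟨-(n .e * B.logz j .e (z (D.side j .e))) + n .f * B.logz j .f (z (D.side j .f)) -
    n .g * B.logz j .g (z (D.side j .g)) + n .h * B.logz j .h (z (D.side j .h)), ?_, ?_⟩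
  · simp only [setW, Function.update_self, PotentialBranch.degTerm]
    exact (((hlog .e).neg.add (hlog .f)).sub (hlog .g)).add (hlog .h)
  · rw [Complex.exp_add, Complex.exp_sub, Complex.exp_add, Complex.exp_neg]
    simp only [Complex.exp_int_mul, hexp]
    have hz0 := hz (D.side j .e)
    have h1 : z (D.side j .e) ^ n .f * z (D.side j .e) ^ n .h =
        z (D.side j .e) ^ n .e * z (D.side j .e) ^ n .g := by
      rw [← zpow_add₀ hz0, ← zpow_add₀ hz0, hn]
    have he := zpow_ne_zero (n .e) hz0
    have hg := zpow_ne_zero (n .g) hz0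
    field_simp
    rw [h1]

end CrossingEquations

/-! ### The explicit solution -/

open Classical in
theorem isSolution_zSol_wSol [Fintype X] (hD : D.EveryComponentOverAndUnder)
    (ha : D.IsArcColoring ρ a) (hs : D.IsRegionColoring a s)
    (hr : ∀ k, det2 (a (D.arc k)) (s (D.right k)) ≠ 0) (hp : D.Avoids a s p) :
    D.IsSolution a (D.zSol a s p) (D.wSol a s p) := by
  have hz := zSol_ne_zero ha hr hp
  have hw0 : ∀ j c, D.wSol a s p j c ≠ 0 := fun j c => cornerRatio_ne_zero hs hp j c
  have hwrel : ∀ j, D.wSol a s p j .e * D.wSol a s p j .g =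
    D.wSol a s p j .f * D.wSol a s p j .h := fun j => cornerRatio_mul hs hp j
  have hwside : ∀ (j : {j : X // D.IsDegenerate a j}) (c c' : Corner),
      D.side j c = D.side j c' → D.wSol a s p j c = D.wSol a s p j c' :=
    fun j c c' h => cornerRatio_eq_of_side_eq hD j.1 c c' h
  refine ⟨hz, fun j hj => zSol_ratio_ne_one ha hs hr hp hj, hw0, hwrel, hwside, ?_,
    fun B => ⟨fun k => ?_, fun j c => ?_⟩⟩
  · refine exists_potentialBranch hz (fun j hj => ?_) fun j c => ?_
    · obtain ⟨h1, h2, h3, h4, -, -⟩ := zSol_ratio_ne_one ha hs hr hp hj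
      simp only [Ne, div_eq_one_iff_eq (hz _)] at h1 h2 h3 h4
      rintro c (rfl | rfl) c' (rfl | rfl) <;> rw [Ne, div_eq_one_iff_eq (hz _)]
      · exact h1
      · exact Ne.symm h2
      · exact Ne.symm h4
      · exact h3
    · rw [wEff_eq (hw0 j) (hwrel j)]
      exact hw0 j c
  · have hterm : ∀ j : X, ∃ e, HasEulerDerivAt
        (fun t => if hj : D.IsDegenerate a j then
          B.degTerm j (Function.update (D.zSol a s p) k t) (D.wSol a s p ⟨j, hj⟩)
          else B.nondegTerm j (Function.update (D.zSol a s p) k t)) e (D.zSol a s p k) ∧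
        Complex.exp e = (if D.side j .e = k then D.cornerFactor s p j .e else 1) *
          (if D.side j .f = k then D.cornerFactor s p j .f else 1) *
          (if D.side j .g = k then D.cornerFactor s p j .g else 1) *
          (if D.side j .h = k then D.cornerFactor s p j .h else 1) := by
      intro j
      by_cases hj : D.IsDegenerate a j
      · simp only [dif_pos hj]
        exact exists_hasEulerDerivAt_degTerm B hj hz (hw0 _) (hwrel _) k
      · simp only [dif_neg hj]
        obtain ⟨h1, h2, h3, h4⟩ := cornerFactor_eq ha hs hr hp hj
        rw [← h1, ← h2, ← h3, ← h4]
        exact exists_hasEulerDerivAt_nondegTerm B hj hz k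
    choose e he hexp using hterm
    have hV : HasEulerDerivAt (fun t => B.V (Function.update (D.zSol a s p) k t)
        (D.wSol a s p)) (∑ j, e j) (D.zSol a s p k) := HasEulerDerivAt.sum he
    rw [hV.mul_deriv, Complex.exp_sum, Finset.prod_congr rfl fun j _ => hexp j]
    exact prod_cornerFactor_eq_one hs hp k
  · have hterm : ∀ i : X, ∃ e, HasEulerDerivAt
        (fun t => if hi : D.IsDegenerate a i then
          B.degTerm i (D.zSol a s p) (D.setW a (D.wSol a s p) j (D.side j c) t ⟨i, hi⟩)
          else B.nondegTerm i (D.zSol a s p)) e (D.wSol a s p j c) ∧ Complex.exp e = 1 := by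
      intro i
      by_cases hi : D.IsDegenerate a i
      · simp only [dif_pos hi]
        by_cases hij : (⟨i, hi⟩ : {j : X // D.IsDegenerate a j}) = j
        · subst hij
          exact exists_hasEulerDerivAt_degTerm_setW B hz ⟨i, hi⟩
            (zSol_eq_of_isDegenerate ha hs hr hi) (hw0 _) (hwrel _) (hwside _) c
        -- Only the summand of the crossing `j` depends on the variables `w^j`.
        · simp only [setW, Function.update_of_ne hij]
          exact ⟨0, HasEulerDerivAt.const _ _, Complex.exp_zero⟩
      · simp only [dif_neg hi]
        exact ⟨0, HasEulerDerivAt.const _ _, Complex.exp_zero⟩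
    choose e he hexp using hterm
    have hV : HasEulerDerivAt (fun t => B.V (D.zSol a s p)
        (D.setW a (D.wSol a s p) j (D.side j c) t)) (∑ i, e i) (D.wSol a s p j c) :=
      HasEulerDerivAt.sum he
    rw [hV.mul_deriv, Complex.exp_sum, Finset.prod_congr rfl fun j _ => hexp j]
    exact Finset.prod_const_one

theorem zSol_eq_one_iff (ha : D.IsArcColoring ρ a)
    (hr : ∀ k, det2 (a (D.arc k)) (s (D.right k)) ≠ 0) (k : X × Strand) :
    D.zSol a s p k = 1 ↔ ∃ c : ℂ, p = s (D.right k) + c • a (D.arc k) := by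
  rw [zSol, div_eq_one_iff_eq (hr k), ← sub_eq_zero, ← det2_sub_right,
    det2_eq_zero_iff (ha.ne_zero _)]
  simp only [sub_eq_iff_eq_add']

end LinkDiagram

end OptLim

end

theorem theorem1 {X : Type u} {R : Type v} [Fintype X] (D : OptLim.LinkDiagram X R)
    (hD : D.EveryComponentOverAndUnder) (ρ : D.LinkGroup →* OptLim.PSL2C)
    (hρ : D.IsBoundaryParabolic ρ) :
    (∃ a : D.Arc → Fin 2 → ℂ, D.IsArcColoring ρ a) ∧
    ∀ a : D.Arc → Fin 2 → ℂ, D.IsArcColoring ρ a →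
      (∃ s : R → Fin 2 → ℂ, D.IsRegionColoring a s ∧ D.IsRegular a s) ∧
      (∀ s : R → Fin 2 → ℂ, D.IsRegionColoring a s → D.IsRegular a s →
        (∃ p : Fin 2 → ℂ, D.Avoids a s p ∧ ∀ k, D.zSol a s p k ≠ 1) ∧
        ∀ p : Fin 2 → ℂ, D.Avoids a s p →
          (∀ k, OptLim.det2 (a (D.arc k)) (s (D.right k)) ≠ 0 ∧ D.zSol a s p k ≠ 0 ∧
            (D.zSol a s p k = 1 ↔ ∃ c : ℂ, p = s (D.right k) + c • a (D.arc k))) ∧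
          (∀ j c, OptLim.det2 (s (D.wDen j c)) p ≠ 0) ∧
          (∀ j c, D.wSol a s p j c ≠ 0 ∧ D.wSol a s p j c ≠ 1) ∧
          (D.zSol a s p, D.wSol a s p) ∈ D.solutionSet a) ∧
      (D.solutionSet a).Nonempty := by
  refine ⟨OptLim.LinkDiagram.exists_isArcColoring hρ, fun a ha => ?_⟩
  obtain ⟨s₀, hs₀, hreg₀⟩ := ha.exists_isRegionColoring
  refine ⟨⟨s₀, hs₀, hreg₀⟩, fun s hs hreg => ⟨ha.exists_avoids hs, fun p hp => ?_⟩, ?_⟩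
  · have hr := (hs.isRegular_iff ha).1 hreg
    exact ⟨fun k => ⟨hr k, OptLim.LinkDiagram.zSol_ne_zero ha hr hp k,
        OptLim.LinkDiagram.zSol_eq_one_iff ha hr k⟩,
      fun j c => OptLim.LinkDiagram.det2_region_ne_zero hs hp _,
      fun j c => ⟨OptLim.LinkDiagram.cornerRatio_ne_zero hs hp j c,
        OptLim.LinkDiagram.cornerRatio_ne_one ha hs hr hp j c⟩,
      OptLim.LinkDiagram.isSolution_zSol_wSol hD ha hs hr hp⟩
  · obtain ⟨p, hp, -⟩ := ha.exists_avoids hs₀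
    exact ⟨(D.zSol a s₀ p, D.wSol a s₀ p), OptLim.LinkDiagram.isSolution_zSol_wSol hD ha hs₀
      ((hs₀.isRegular_iff ha).1 hreg₀) hp⟩
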